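/- **The $\hbar^{n-2}$ property for $q$-th reductions of KP.** *Setting.* Let $\mathcal A$ be a commutative $\mathbb C$-algebra of functions of $t$ and of points $x_0,x_1,x_2,\dots$: it contains the field $\mathbb C(x_0,x_1,\dots)$ and carries commuting $\mathbb C$-linear derivations $\partial_t$, $\partial_{x_j}$ with $\partial_t x_j=0$, $\partial_{x_i}x_j=\delta_{ij}$. We work with formal WKB expressions, i.e. finite sums $\sum_s f_s\,e^{s/\hbar}$ with $s\in\mathcal A$, $f_s\in\mathcal A((\hbar))$, on which the derivations act by $\partial(f e^{s/\hbar})=(\partial f+\hbar^{-1}(\partial s)f)e^{s/\hbar}$. We write $f\in O(\hbar^k)$ if $f\in\hbar^k\mathcal A[[\hbar]]$ (in particular $f$ contains no exponential); for a matrix this is meant entrywise. Let $u_0,\dots,u_{q-1}\in\mathcal A[[\hbar]]$ depend on $t$ only, let $Q=(\hbar\partial_t)^q+\sum_{l=0}^{q-1}u_l(t)(\hbar\partial_t)^l$, and for each point $x=x_j$ let $\psi_a(x,t)=f_a(x,t)\,e^{S_a(x,t)/\hbar}$ $(1\le a\le q)$, with $S_a\in\mathcal A$, $f_a\in\mathcal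 A[[\hbar]]$ depending on $x$ and $t$ only, be solutions of $Q\psi_a=x\psi_a$ such that the semiclassical eigenvalues $\partial_tS_a$ have invertible pairwise differences and the leading terms of the $f_a$ are invertible. Put $$\Psi(x)=\big((\hbar\partial_t)^{i-1}\psi_a(x,t)\big)_{1\le i,a\le q},\quad P(\overset{a}{x})=\Psi(x)E_a\Psi(x)^{-1},\quad K(x,y)=\frac{\Psi(x)^{-1}\Psi(y)}{x-y},$$ where $E_a$ is the matrix whose only non-zero entry is a $1$ at $(a,a)$. The correlators are $W_1(\overset{a}{x})=\lim_{x'\to x}\big(K_{a,a}(x,x')-\frac1{x-x'}\big)=-\big(\Psi(x)^{-1}\partial_x\Psi(x)\big)_{a,a}$ and, for $n\ge2$, $$W_n(\overset{a_1}{x_1},\dots,\overset{a_n}{x_n})=(-1)^{n+1}\sum_{\sigma\ n\text{-cycle}}\ \prod_{i=1}^nK_{a_i,a_{\sigma(i)}}(x_i,x_{\sigma(i)}).$$ Let $B(\overset{a}{x})$ be the strictly lower triangular $q\times q$ matrix with $B_{l,n}=P_{l-n,\,q}(\overset{a}{x})$ for $l>n$. *Insertion operators.* For a set $X$ of points let $\mathbb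 B_X$ be the ring generated by $\mathbb C((\hbar))$, the rational functions of the points of $X$, and the entries of $\Psi(x)$ and $(\det\Psi(x))^{-1}$ for $x\in X$, and closed under $\partial_t$ and $\partial_x$, $x\in X$. An insertion operator is a family of derivations $\delta_y^a$ ($y$ a point, $1\le a\le q$), defined on the functions of the points other than $y$, with $\delta_y^a(\mathbb B_X)\subseteq\mathbb B_{X\cup\{y\}}$ for $y\notin X$, vanishing on $\mathbb C((\hbar))$ and on rational functions of the points, commuting with $\partial_x$ for $x\neq y$, and such that there are matrices $U(\overset{a}{y})$ with entries in $\mathbb B_{\{y\}}$ with, for distinct points $x,y$, $$\delta_y^a\Psi(x)=\Big(\frac{P(\overset{a}{y})}{x-y}+U(\overset{a}{y})\Big)\Psi(x),\qquad \delta_x^aU(\overset{b}{y})-\delta_y^bU(\overset{a}{x})=[U(\overset{a}{x}),U(\overset{b}{y})].$$ It is compatible if every $\delta_y^a$ commutes with $\partial_t$. *Statement.* Let $\delta$ be a compatible insertion operator such that $U(\overset{a}{y})=B(\overset{a}{y})+\hbar\,V(\overset{a}{y})$, where the entries of $V(\overset{a}{y})$ are polynomials in the entries of the projectors $P(\overset{b}{y})$,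 $1\le b\le q$, and their $t$-derivatives of all orders, with coefficients in the ring generated by $\mathbb C[[\hbar]]$ and $\mathbb C(y)$ (so that $V=O(1)$). Then, for all $k\ge0$, pairwise distinct points $y_1,\dots,y_k,x$ and all $a_1,\dots,a_k,b$, $$\delta_{y_1}^{a_1}\cdots\delta_{y_k}^{a_k}P(\overset{b}{x})\in O(\hbar^k),$$ and for all $n\ge1$, pairwise distinct points $x_1,\dots,x_n$ and all $a_1,\dots,a_n$, $$W_n(\overset{a_1}{x_1},\dots,\overset{a_n}{x_n})\in O(\hbar^{n-2}).$$ -/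

import Mathlib

noncomputable section

namespace KP

/-! ### Formal series in `ħ` and formal WKB expressions -/

/-- The ring of formal WKB expressions over an algebra `𝒜` of coefficient functions: finite sums
`∑ f_s * exp (s / ħ)` where the `s` are elements of `𝒜` and the `f_s` are formal Laurent series in
`ħ` with coefficients in `𝒜`. The element `f * exp (s / ħ)` is `AddMonoidAlgebra.single s f`, so
`exp (s / ħ) * exp (s' / ħ) = exp ((s + s') / ħ)`. -/
abbrev WKB (𝒜 : Type*) [CommRing 𝒜] : Type _ := AddMonoidAlgebra (LaurentSeries 𝒜) 𝒜

section Operators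

variable {𝒜 : Type*} [CommRing 𝒜] [Algebra ℂ 𝒜]

/-- A Laurent series in `ħ`, seen as a WKB expression without exponentials. -/
def ofSeries (f : LaurentSeries 𝒜) : WKB 𝒜 := AddMonoidAlgebra.single 0 f

/-- A coefficient function, seen as a WKB expression. -/
def ofCoef (f : 𝒜) : WKB 𝒜 := ofSeries (HahnSeries.single 0 f)

/-- The formal parameter `ħ`. -/
def hbar : WKB 𝒜 := ofSeries (HahnSeries.single 1 1)

/-- `f ∈ O(ħ ^ k)`: `f` is free of exponentials, and is a formal series in `ħ` with coefficients in
`𝒜` that contains only powers `ħ ^ n` with `n ≥ k`. -/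
def IsBigOh (k : ℤ) (f : WKB 𝒜) : Prop :=
  ∃ g : LaurentSeries 𝒜, (∀ n < k, g.coeff n = 0) ∧ f = ofSeries g

/-- The coefficientwise extension of a derivation of `𝒜` to Laurent series in `ħ`. -/
def seriesDeriv (D : Derivation ℂ 𝒜 𝒜) : LaurentSeries 𝒜 →+ LaurentSeries 𝒜 where
  toFun f := HahnSeries.map f D
  map_zero' := by ext n; simp
  map_add' f g := by ext n; simp

theorem seriesDeriv_mul (D : Derivation ℂ 𝒜 𝒜) (f g : LaurentSeries 𝒜) :
    seriesDeriv D (f * g) = f * seriesDeriv D g + g * seriesDeriv D f := by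
  have hf : (HahnSeries.map f D).support ⊆ f.support := fun n hn h0 => hn (by
    simp only [HahnSeries.map_coeff]
    rw [h0, map_zero])
  have hg : (HahnSeries.map g D).support ⊆ g.support := fun n hn h0 => hn (by
    simp only [HahnSeries.map_coeff]
    rw [h0, map_zero])
  ext n
  simp only [seriesDeriv, AddMonoidHom.coe_mk, ZeroHom.coe_mk]
  rw [HahnSeries.coeff_add, mul_comm g, HahnSeries.coeff_mul_right' g.isPWO_support hg,
    HahnSeries.coeff_mul_left' f.isPWO_support hf, HahnSeries.map_coeff,
    HahnSeries.coeff_mul, map_sum, ← Finset.sum_add_distrib]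
  refine Finset.sum_congr rfl fun p _ => ?_
  simp only [Derivation.leibniz, smul_eq_mul, HahnSeries.map_coeff]
  ring

/-- The action of a derivation `D` of `𝒜` on `f * exp (s / ħ)`, namely
`(D f + ħ⁻¹ * D s * f) * exp (s / ħ)`. -/
def wkbDerivTerm (D : Derivation ℂ 𝒜 𝒜) (s : 𝒜) : LaurentSeries 𝒜 →+ WKB 𝒜 where
  toFun f := AddMonoidAlgebra.single s (seriesDeriv D f + HahnSeries.single (-1) (D s) * f)
  map_zero' := by simp
  map_add' f g := by
    rw [← AddMonoidAlgebra.single_add]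
    congr 1
    rw [map_add]
    ring

/-- The derivation of the ring of WKB expressions induced by a derivation `D` of `𝒜`:
`f * exp (s / ħ) ↦ (D f + ħ⁻¹ * D s * f) * exp (s / ħ)`. -/
def wkbDeriv (D : Derivation ℂ 𝒜 𝒜) : WKB 𝒜 →+ WKB 𝒜 :=
  (Finsupp.liftAddHom (wkbDerivTerm D)).comp AddMonoidAlgebra.coeffAddEquiv.toAddMonoidHom

theorem wkbDeriv_single (D : Derivation ℂ 𝒜 𝒜) (s : 𝒜) (f : LaurentSeries 𝒜) :
    wkbDeriv D (AddMonoidAlgebra.single s f) =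
      AddMonoidAlgebra.single s (seriesDeriv D f + HahnSeries.single (-1) (D s) * f) := by
  simp [wkbDeriv, wkbDerivTerm]

theorem wkbDeriv_mul (D : Derivation ℂ 𝒜 𝒜) (f g : WKB 𝒜) :
    wkbDeriv D (f * g) = f * wkbDeriv D g + g * wkbDeriv D f := by
  induction f using AddMonoidAlgebra.induction_linear with
  | zero => simp
  | add f f' hf hf' => rw [add_mul, map_add, hf, hf', map_add]; ring
  | single s f =>
    induction g using AddMonoidAlgebra.induction_linear with
    | zero => simp
    | add g g' hg hg' => rw [mul_add, map_add, hg, hg', map_add]; ring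
    | single s' g =>
      have h : (HahnSeries.single (-1) (D (s + s')) : LaurentSeries 𝒜) =
          HahnSeries.single (-1) (D s) + HahnSeries.single (-1) (D s') := by
        rw [map_add]
        exact map_add (HahnSeries.single.addMonoidHom (-1 : ℤ)) _ _
      rw [AddMonoidAlgebra.single_mul_single, wkbDeriv_single, wkbDeriv_single,
        wkbDeriv_single, AddMonoidAlgebra.single_mul_single,
        AddMonoidAlgebra.single_mul_single, add_comm s' s, ← AddMonoidAlgebra.single_add,
        seriesDeriv_mul, h]
      congr 1
      ring

end Operators

/-! ### Coefficient functions -/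

/-- The field `ℂ(x_0, x_1, …)` of rational functions in countably many variables (the points at
which the correlators are evaluated). -/
abbrev RatFun : Type := FractionRing (MvPolynomial ℕ ℂ)

/-- The coordinate `x_j`. -/
def coord (j : ℕ) : RatFun := algebraMap (MvPolynomial ℕ ℂ) RatFun (MvPolynomial.X j)

/-- The field `ℂ(x_j : j ∈ S)`. -/
def ratIn (S : Set ℕ) : IntermediateField ℂ RatFun := IntermediateField.adjoin ℂ (coord '' S)

/-- The structure of an algebra of functions of `t, x_0, x_1, …` on a commutative `ℂ`-algebra: it
contains the rational functions of the `x_j` and carries the commuting derivations `∂/∂t` and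
`∂/∂x_j`. -/
structure FunctionAlgebra (𝒜 : Type*) [CommRing 𝒜] [Algebra ℂ 𝒜] where
  rat : RatFun →ₐ[ℂ] 𝒜
  dt : Derivation ℂ 𝒜 𝒜
  dx : ℕ → Derivation ℂ 𝒜 𝒜
  dt_coord : ∀ j, dt (rat (coord j)) = 0
  dx_coord : ∀ i j, dx i (rat (coord j)) = if i = j then 1 else 0
  dt_dx : ∀ i f, dt (dx i f) = dx i (dt f)
  dx_dx : ∀ i j f, dx i (dx j f) = dx j (dx i f)

namespace FunctionAlgebra

variable {𝒜 : Type*} [CommRing 𝒜] [Algebra ℂ 𝒜] (F : FunctionAlgebra 𝒜)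

/-- `∂/∂t` on WKB expressions. -/
def Dt : WKB 𝒜 →+ WKB 𝒜 := wkbDeriv F.dt

/-- `∂/∂x_i` on WKB expressions. -/
def Dx (i : ℕ) : WKB 𝒜 →+ WKB 𝒜 := wkbDeriv (F.dx i)

/-- The operator `ħ ∂/∂t`. -/
def hDt (f : WKB 𝒜) : WKB 𝒜 := hbar * F.Dt f

/-- A rational function of the `x_j`, seen as a WKB expression. -/
def ratW (r : RatFun) : WKB 𝒜 := ofCoef (F.rat r)

end FunctionAlgebra

/-! ### The `q`-th reduction of KP -/

/-- The wave function with action `S` and amplitude `f`: `f * exp (S / ħ)`. -/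
def wave {𝒜 : Type*} [CommRing 𝒜] (S : 𝒜) (f : PowerSeries 𝒜) : WKB 𝒜 :=
  AddMonoidAlgebra.single S (HahnSeries.ofPowerSeries ℤ 𝒜 f)

/-- The differential operator `Q = (ħ ∂_t) ^ q + ∑_{l < q} u_l (ħ ∂_t) ^ l`. -/
def opQ {𝒜 : Type*} [CommRing 𝒜] [Algebra ℂ 𝒜] (F : FunctionAlgebra 𝒜) {q : ℕ}
    (u : Fin q → PowerSeries 𝒜) (f : WKB 𝒜) : WKB 𝒜 :=
  F.hDt^[q] f +
    ∑ l : Fin q, ofSeries (HahnSeries.ofPowerSeries ℤ 𝒜 (u l)) * F.hDt^[(l : ℕ)] f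

/-- A formal solution of the linear system of a `q`-th reduction of KP, at all the points `x_j`:
functions `u_0(t), …, u_{q-1}(t)`, formal series in `ħ`, and for every `j` a family
`ψ_a(x_j, t) = amp j a * exp (act j a / ħ)`, for `1 ≤ a ≤ q`, of WKB solutions of
`Q ψ = x_j ψ`, at a point where the semiclassical eigenvalues `z_a = ∂_t S_a` are pairwise distinct
and the leading amplitudes do not vanish. -/
structure Reduction {𝒜 : Type*} [CommRing 𝒜] [Algebra ℂ 𝒜] (F : FunctionAlgebra 𝒜) (q : ℕ) where
  u : Fin q → PowerSeries 𝒜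
  act : ℕ → Fin q → 𝒜
  amp : ℕ → Fin q → PowerSeries 𝒜
  dx_u : ∀ i l n, F.dx i (PowerSeries.coeff n (u l)) = 0
  dx_act : ∀ i j a, i ≠ j → F.dx i (act j a) = 0
  dx_amp : ∀ i j a n, i ≠ j → F.dx i (PowerSeries.coeff n (amp j a)) = 0
  eigenvalues_distinct : ∀ j a b, a ≠ b → IsUnit (F.dt (act j a) - F.dt (act j b))
  amp_unit : ∀ j a, IsUnit (PowerSeries.constantCoeff (amp j a))
  equation : ∀ j a, opQ F u (wave (act j a) (amp j a)) =
    F.ratW (coord j) * wave (act j a) (amp j a)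

namespace Reduction

variable {𝒜 : Type*} [CommRing 𝒜] [Algebra ℂ 𝒜] {F : FunctionAlgebra 𝒜} {q : ℕ}
  (κ : Reduction F q)

/-- The matrix `Ψ(x_j, t)`, with entries `(ħ ∂_t) ^ i ψ_a(x_j, t)` for `0 ≤ i < q`, `a` in `Fin q`. -/
def Psi (j : ℕ) : Matrix (Fin q) (Fin q) (WKB 𝒜) :=
  Matrix.of fun i a => F.hDt^[(i : ℕ)] (wave (κ.act j a) (κ.amp j a))

/-- The projector `P(x_j^a) = Ψ(x_j) E_a Ψ(x_j)⁻¹`. -/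
def P (j : ℕ) (a : Fin q) : Matrix (Fin q) (Fin q) (WKB 𝒜) :=
  κ.Psi j * Matrix.single a a 1 * (κ.Psi j)⁻¹

/-- The kernel `K(x_i, x_j) = Ψ(x_i)⁻¹ Ψ(x_j) / (x_i - x_j)`. -/
def K (i j : ℕ) : Matrix (Fin q) (Fin q) (WKB 𝒜) :=
  F.ratW (coord i - coord j)⁻¹ • ((κ.Psi i)⁻¹ * κ.Psi j)

open Classical in
/-- The correlators `W_n(x_{j_1}^{a_1}, …, x_{j_n}^{a_n})`. For `n = 1`, the limit of
`K_{a,a}(x, x') - 1 / (x - x')` when `x' → x` is `- (Ψ(x)⁻¹ ∂_x Ψ(x))_{a,a}`, as the first order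
expansion of `Ψ(x')` at `x` shows. For `n ≥ 2` it is `(-1) ^ (n + 1)` times the sum over `n`-cycles. -/
def W : (n : ℕ) → (Fin n → ℕ) → (Fin n → Fin q) → WKB 𝒜
  | 1, j, a => -((κ.Psi (j 0))⁻¹ * (κ.Psi (j 0)).map (F.Dx (j 0))) (a 0) (a 0)
  | n, j, a => (-1) ^ (n + 1) *
      ∑ σ ∈ Finset.univ.filter
          (fun σ : Equiv.Perm (Fin n) => σ.IsCycle ∧ σ.support = Finset.univ),
        ∏ i, κ.K (j i) (j (σ i)) (a i) (a (σ i))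

/-- The matrix `B(x_j^a)`, with entries `B_{l,n} = P_{l-n,q}(x_j^a)` (rows and columns numbered from
`1` to `q`) for `l > n`, and `0` for `l ≤ n`. -/
def B (j : ℕ) (a : Fin q) : Matrix (Fin q) (Fin q) (WKB 𝒜) :=
  Matrix.of fun l n =>
    if h : n < l then κ.P j a ⟨l - n - 1, by omega⟩ ⟨q - 1, by omega⟩ else 0

/-- The ring of functions of the points `x_j`, `j ∈ S`: the differential ring generated by the
constants (Laurent series in `ħ` with complex coefficients), the rational functions of the `x_j`, the
entries of `Ψ(x_j)` and `(det Ψ(x_j))⁻¹`, for `j ∈ S`. -/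
def pointRing (S : Set ℕ) : Subring (WKB 𝒜) :=
  sInf {T : Subring (WKB 𝒜) |
    (∀ f : LaurentSeries 𝒜, (∀ n, f.coeff n ∈ Set.range (algebraMap ℂ 𝒜)) → ofSeries f ∈ T) ∧
    (∀ r ∈ ratIn S, F.ratW r ∈ T) ∧
    (∀ j ∈ S, (∀ k a, κ.Psi j k a ∈ T) ∧ Ring.inverse (κ.Psi j).det ∈ T) ∧
    (∀ f ∈ T, F.Dt f ∈ T) ∧
    (∀ i ∈ S, ∀ f ∈ T, F.Dx i f ∈ T)}

/-- The expressions in the matrix elements of the projectors at the point `x_j` and their time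
derivatives: polynomials in the `∂_t ^ m P_{k,l}(x_j^b)` whose coefficients are generated by the
rational functions of `x_j` and the power series in `ħ` with complex coefficients (no negative powers
of `ħ`, so that these expressions are of order `1`). -/
def expressions (j : ℕ) : Subring (WKB 𝒜) :=
  sInf {T : Subring (WKB 𝒜) |
    (∀ f : LaurentSeries 𝒜, (∀ n, f.coeff n ∈ Set.range (algebraMap ℂ 𝒜)) →
      (∀ n < 0, f.coeff n = 0) → ofSeries f ∈ T) ∧
    (∀ r ∈ ratIn {j}, F.ratW r ∈ T) ∧
    (∀ b k l, κ.P j b k l ∈ T) ∧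
    (∀ f ∈ T, F.Dt f ∈ T)}

open Classical in
/-- A derivation defined on a subring of the WKB expressions, as a function on all of them; it is only
used at arguments in the subring. -/
def applyDer {T : Subring (WKB 𝒜)} (D : Derivation ℤ T (WKB 𝒜)) (f : WKB 𝒜) : WKB 𝒜 :=
  if h : f ∈ T then D ⟨f, h⟩ else 0

/-- An insertion operator: derivations `δ_y^a`, for every point `y = x_j` and every `a`, defined on the
functions of the points other than `y`, with values in the functions of those points and `y`. -/
structure InsertionOperator where
  der : (j : ℕ) → Fin q → Derivation ℤ (κ.pointRing {j}ᶜ) (WKB 𝒜)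
  der_mem : ∀ (j : ℕ) (a : Fin q) (S : Set ℕ), j ∉ S →
    ∀ f ∈ κ.pointRing S, applyDer (der j a) f ∈ κ.pointRing (insert j S)
  der_const : ∀ (j : ℕ) (a : Fin q) (f : LaurentSeries 𝒜),
    (∀ n, f.coeff n ∈ Set.range (algebraMap ℂ 𝒜)) → applyDer (der j a) (ofSeries f) = 0
  der_rat : ∀ (j : ℕ) (a : Fin q), ∀ r ∈ ratIn {j}ᶜ, applyDer (der j a) (F.ratW r) = 0
  der_dx : ∀ (j : ℕ) (a : Fin q) (i : ℕ), i ≠ j → ∀ f ∈ κ.pointRing {j}ᶜ,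
    applyDer (der j a) (F.Dx i f) = F.Dx i (applyDer (der j a) f)
  /-- The matrix `U(x_j^a)`. -/
  U : ℕ → Fin q → Matrix (Fin q) (Fin q) (WKB 𝒜)
  U_mem : ∀ j a k l, U j a k l ∈ κ.pointRing {j}
  /-- `δ_y^a Ψ(x) = (P(y^a) / (x - y) + U(y^a)) Ψ(x)`. -/
  der_Psi : ∀ (j : ℕ) (a : Fin q) (i : ℕ), i ≠ j →
    (κ.Psi i).map (applyDer (der j a)) =
      (F.ratW (coord i - coord j)⁻¹ • κ.P j a + U j a) * κ.Psi i
  /-- `δ_x^a U(y^b) - δ_y^b U(x^a) = [U(x^a), U(y^b)]`. -/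
  der_U : ∀ (i j : ℕ) (a b : Fin q), i ≠ j →
    (U j b).map (applyDer (der i a)) - (U i a).map (applyDer (der j b)) =
      U i a * U j b - U j b * U i a

namespace InsertionOperator

variable {κ} (δ : κ.InsertionOperator)

/-- The function `δ_y^a`, `y = x_j`. -/
def app (j : ℕ) (a : Fin q) : WKB 𝒜 → WKB 𝒜 := applyDer (δ.der j a)

/-- The insertion operator is compatible when it commutes with `∂_t`. -/
def Compatible : Prop :=
  ∀ (j : ℕ) (a : Fin q), ∀ f ∈ κ.pointRing {j}ᶜ, δ.app j a (F.Dt f) = F.Dt (δ.app j a f)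

/-- Successive insertions: for the list `[(j_1, a_1), …, (j_k, a_k)]`, the operator
`δ_{y_1}^{a_1} ⋯ δ_{y_k}^{a_k}` with `y_i = x_{j_i}`. -/
def iter (l : List (ℕ × Fin q)) (f : WKB 𝒜) : WKB 𝒜 :=
  l.foldr (fun p g => δ.app p.1 p.2 g) f

end InsertionOperator

end Reduction

end KP

end

noncomputable section

namespace KP

/-! ### Derivations defined on a subring -/

/-! The core is to show that each insertion in the projectors gains a factor `ħ`, uniformly under
further insertions. This is encoded by `Good k S f`: `f` is an `O(1)` function of the points in `S`,
and applying `ħ⁻¹ δ` up to `k` times at new points keeps it so. Good functions form a ring stable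
under `∂_t`, by the Leibniz rule and compatibility. The central result `good_u_and_P` shows by
induction on `k` that the `u_l` and all entries of `P(x)` are good at every level.

For the `u_l`: zero curvature gives `δ L` for the companion (Lax) matrix `L`. The pole at `x = y`
cancels, because `ħ ∂_t P = [L, P]` and `L(x) - L(y)` is `x - y` times a corner matrix. The last row
of what remains at order one telescopes, by the shape of `B`, into entries of `ħ ∂_t P(y)`
(`last_row_commutator`). As `U - B = ħ V`, the whole last row, hence `δ u_l`, carries a factor `ħ`.

For `P`: put `X = ħ⁻¹ δ P`. Then `ħ X` is good because `δ P` is a commutator of good matrices, `[L,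
X]` is good by differentiating `ħ ∂_t P = [L, P]`, and `X P + P X = X` since `P² = P`. At `ħ = 0`,
`L` has eigenvalues with invertible differences, so a matrix commuting with it is diagonal in its
eigenbasis, and the projector relation then forces it to vanish. So `ħ X` is divisible by `ħ`, and
differentiating the relations propagates this to all levels (`Good.of_commutator`).

For the correlators: `δ K(x, x') = -K(x, y) K(y, x')`, so inserting `y` in every arrow of every
cycle turns `W_n` into `W_{n+1}` for `n ≥ 2` (`app_W`). Since `W_2` is a rational factor times a
trace of two projectors (`W_two`), it is good, and each further point costs one `ħ`. `W_1` is
estimated directly. -/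

/-- `d` is additive and satisfies the Leibniz rule on the subring `T`. -/
structure DerivOn {R : Type*} [CommRing R] (T : Subring R) (d : R → R) : Prop where
  add : ∀ f ∈ T, ∀ g ∈ T, d (f + g) = d f + d g
  mul : ∀ f ∈ T, ∀ g ∈ T, d (f * g) = f * d g + g * d f

namespace DerivOn

variable {R : Type*} [CommRing R] {T : Subring R} {d : R → R}

theorem zero (hd : DerivOn T d) : d 0 = 0 := by
  simpa using hd.add 0 T.zero_mem 0 T.zero_mem

theorem one (hd : DerivOn T d) : d 1 = 0 := by
  simpa using hd.mul 1 T.one_mem 1 T.one_mem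

theorem neg (hd : DerivOn T d) {f : R} (hf : f ∈ T) : d (-f) = -d f := by
  have h := hd.add f hf (-f) (T.neg_mem hf)
  rw [add_neg_cancel, hd.zero] at h
  linear_combination -h

theorem sub (hd : DerivOn T d) {f g : R} (hf : f ∈ T) (hg : g ∈ T) : d (f - g) = d f - d g := by
  rw [sub_eq_add_neg, hd.add f hf _ (T.neg_mem hg), hd.neg hg, sub_eq_add_neg]

theorem sum (hd : DerivOn T d) {ι : Type*} (s : Finset ι) {f : ι → R} (hf : ∀ i ∈ s, f i ∈ T) :
    d (∑ i ∈ s, f i) = ∑ i ∈ s, d (f i) := by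
  classical
  induction s using Finset.induction_on with
  | empty => simpa using hd.zero
  | insert a s ha ih =>
    have hs : ∀ i ∈ s, f i ∈ T := fun i hi => hf i (Finset.mem_insert_of_mem hi)
    rw [Finset.sum_insert ha, Finset.sum_insert ha,
      hd.add _ (hf a (Finset.mem_insert_self a s)) _ (T.sum_mem hs), ih hs]

theorem prod (hd : DerivOn T d) {ι : Type*} [DecidableEq ι] (s : Finset ι) {f : ι → R}
    (hf : ∀ i ∈ s, f i ∈ T) :
    d (∏ i ∈ s, f i) = ∑ i ∈ s, d (f i) * ∏ k ∈ s.erase i, f k := by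
  induction s using Finset.induction_on with
  | empty => simpa using hd.one
  | insert a s ha ih =>
    have hs : ∀ i ∈ s, f i ∈ T := fun i hi => hf i (Finset.mem_insert_of_mem hi)
    rw [Finset.prod_insert ha, Finset.sum_insert ha, Finset.erase_insert ha,
      hd.mul _ (hf a (Finset.mem_insert_self a s)) _ (T.prod_mem hs), ih hs, Finset.mul_sum,
      add_comm, mul_comm]
    congr 1
    refine Finset.sum_congr rfl fun i hi => ?_
    have hai : a ≠ i := fun h => ha (h ▸ hi)
    rw [Finset.erase_insert_of_ne hai, Finset.prod_insert (by simp [ha])]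
    ring

variable {ι : Type*} [Fintype ι]

theorem map_matrix_mul (hd : DerivOn T d) {A B : Matrix ι ι R} (hA : ∀ i j, A i j ∈ T)
    (hB : ∀ i j, B i j ∈ T) : (A * B).map d = A.map d * B + A * B.map d := by
  ext i j
  simp only [Matrix.map_apply, Matrix.mul_apply, Matrix.add_apply]
  rw [hd.sum _ fun k _ => T.mul_mem (hA i k) (hB k j), ← Finset.sum_add_distrib]
  refine Finset.sum_congr rfl fun k _ => ?_
  rw [hd.mul _ (hA i k) _ (hB k j)]
  ring

/-- Differentiate `A A⁻¹ = 1`. The entries of `A⁻¹` are required in `T` because the Leibniz rule is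
only available there. -/
theorem map_matrix_inv (hd : DerivOn T d) [DecidableEq ι] {A : Matrix ι ι R} (hu : IsUnit A.det)
    (hA : ∀ i j, A i j ∈ T) (hA' : ∀ i j, A⁻¹ i j ∈ T) :
    (A⁻¹).map d = -(A⁻¹ * A.map d * A⁻¹) := by
  have h := hd.map_matrix_mul hA hA'
  have h1 : (1 : Matrix ι ι R).map d = 0 := by
    ext i j
    by_cases hij : i = j <;> simp [hij, hd.one, hd.zero]
  rw [Matrix.mul_nonsing_inv A hu, h1] at h
  have h2 : A * (A⁻¹).map d = -(A.map d * A⁻¹) := (neg_eq_of_add_eq_zero_right h.symm).symm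
  calc (A⁻¹).map d = A⁻¹ * (A * (A⁻¹).map d) := by
        rw [← Matrix.mul_assoc, Matrix.nonsing_inv_mul A hu, Matrix.one_mul]
    _ = _ := by rw [h2, Matrix.mul_neg, Matrix.mul_assoc]

/-- If `d Ψ = N Ψ` then `d (Ψ E Ψ⁻¹) = [N, Ψ E Ψ⁻¹]` for a matrix unit `E`. -/
theorem map_conj_single (hd : DerivOn T d) [DecidableEq ι] {A N : Matrix ι ι R}
    (hu : IsUnit A.det) (hA : ∀ i j, A i j ∈ T) (hA' : ∀ i j, A⁻¹ i j ∈ T)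
    (hN : A.map d = N * A) (a : ι) :
    (A * Matrix.single a a 1 * A⁻¹).map d =
      N * (A * Matrix.single a a 1 * A⁻¹) - A * Matrix.single a a 1 * A⁻¹ * N := by
  have hE : ∀ i j, (Matrix.single a a 1 : Matrix ι ι R) i j ∈ T := by
    intro i j
    rw [Matrix.single_apply]
    split_ifs
    · exact T.one_mem
    · exact T.zero_mem
  have hE' : (Matrix.single a a 1 : Matrix ι ι R).map d = 0 := by
    ext i j
    rw [Matrix.map_apply, Matrix.single_apply]
    split_ifs
    · simpa using hd.one
    · simpa using hd.zero
  have hAE : ∀ i j, (A * Matrix.single a a 1 : Matrix ι ι R) i j ∈ T := fun i j => by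
    rw [Matrix.mul_apply]
    exact T.sum_mem fun k _ => T.mul_mem (hA i k) (hE k j)
  rw [hd.map_matrix_mul hAE hA', hd.map_matrix_mul hA hE, hE', hd.map_matrix_inv hu hA hA', hN,
    Matrix.mul_zero, add_zero, Matrix.mul_neg, ← sub_eq_add_neg]
  congr 1
  · simp only [Matrix.mul_assoc]
  · rw [← Matrix.mul_assoc A⁻¹ N A, Matrix.mul_assoc (A⁻¹ * N), Matrix.mul_nonsing_inv A hu,
      Matrix.mul_one]
    simp only [Matrix.mul_assoc]

end DerivOn

/-! ### Subrings and matrices -/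

theorem mul_single_mul_apply {R ι : Type*} [CommRing R] [Fintype ι] [DecidableEq ι]
    (A B : Matrix ι ι R) (a b c : ι) :
    (A * (Matrix.single c c 1 : Matrix ι ι R) * B) a b = A a c * B c b := by
  rw [Matrix.mul_assoc, Matrix.mul_apply, Finset.sum_eq_single c]
  · simp
  · intro l _ hl
    rw [Matrix.single_mul_apply_of_ne _ _ _ _ _ hl, mul_zero]
  · simp

/-- The common term `U` cancels; this is why the insertion in the kernel `K` does not see the matrix
`U`. -/
theorem mul_smul_add_mul_sub {R ι : Type*} [CommRing R] [Fintype ι] (r s : R)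
    (A B P U : Matrix ι ι R) :
    -(A * (r • P + U)) * B + A * ((s • P + U) * B) = (s - r) • (A * P * B) := by
  simp only [Matrix.mul_add, Matrix.add_mul, Matrix.mul_smul, Matrix.smul_mul, Matrix.neg_mul,
    Matrix.mul_assoc, sub_smul]
  abel

theorem matrix_mul_mem {R ι : Type*} [CommRing R] [Fintype ι] {T : Subring R} {A B : Matrix ι ι R}
    (hA : ∀ i j, A i j ∈ T) (hB : ∀ i j, B i j ∈ T) (i j : ι) : (A * B) i j ∈ T := by
  rw [Matrix.mul_apply]
  exact T.sum_mem fun k _ => T.mul_mem (hA i k) (hB k j)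

theorem matrix_sub_mem {R ι : Type*} [CommRing R] {T : Subring R} {A B : Matrix ι ι R}
    (hA : ∀ i j, A i j ∈ T) (hB : ∀ i j, B i j ∈ T) (i j : ι) : (A - B) i j ∈ T :=
  T.sub_mem (hA i j) (hB i j)

/-- The adjugate is polynomial in the entries. With the inverse determinant, this puts `Ψ⁻¹` in the
ring of functions of the points. -/
theorem adjugate_mem {R ι : Type*} [CommRing R] [Fintype ι] [DecidableEq ι] {T : Subring R}
    {A : Matrix ι ι R} (hA : ∀ i j, A i j ∈ T) (i j : ι) : A.adjugate i j ∈ T := by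
  have h : A = T.subtype.mapMatrix (Matrix.of fun i j => (⟨A i j, hA i j⟩ : T)) := by
    ext i j; rfl
  rw [h, ← RingHom.map_adjugate]
  exact Subtype.prop _

/-! ### Series without exponentials -/

section Series

variable {𝒜 : Type*} [CommRing 𝒜]

/-- Formal power series in `ħ`, seen as WKB expressions. -/
def ofPS : PowerSeries 𝒜 →+* WKB 𝒜 :=
  (AddMonoidAlgebra.singleZeroRingHom (R := LaurentSeries 𝒜) (M := 𝒜)).comp
    (HahnSeries.ofPowerSeries ℤ 𝒜)

theorem ofPS_apply (f : PowerSeries 𝒜) :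
    ofPS f = AddMonoidAlgebra.single 0 (HahnSeries.ofPowerSeries ℤ 𝒜 f) := rfl

theorem single_ofPowerSeries (s : 𝒜) (f : PowerSeries 𝒜) :
    (AddMonoidAlgebra.single s (HahnSeries.ofPowerSeries ℤ 𝒜 f) : WKB 𝒜) =
      ofPS f * AddMonoidAlgebra.single s 1 := by
  rw [ofPS_apply, AddMonoidAlgebra.single_mul_single, zero_add, mul_one]

theorem single_ofPowerSeries_injective (s : 𝒜) : Function.Injective fun f : PowerSeries 𝒜 =>
    (AddMonoidAlgebra.single s (HahnSeries.ofPowerSeries ℤ 𝒜 f) : WKB 𝒜) := fun _ _ h =>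
  HahnSeries.ofPowerSeries_injective (AddMonoidAlgebra.single_right_injective h)

theorem ofPS_injective : Function.Injective (ofPS : PowerSeries 𝒜 → WKB 𝒜) :=
  single_ofPowerSeries_injective 0

theorem ofPS_X : ofPS (PowerSeries.X : PowerSeries 𝒜) = hbar := by
  rw [ofPS_apply, HahnSeries.ofPowerSeries_X]; rfl

/-- Identifies `O(1)` with the image of an injective ring homomorphism, so that closure properties
and divisibility by `ħ` can be read off power series. -/
theorem isBigOh_zero_iff {f : WKB 𝒜} : IsBigOh 0 f ↔ ∃ g, f = ofPS g := by
  constructor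
  · rintro ⟨g, hg, rfl⟩
    refine ⟨PowerSeries.mk fun n => g.coeff n, ?_⟩
    rw [ofPS_apply, ofSeries]
    congr 1
    ext n
    obtain hn | hn := lt_or_ge n 0
    · rw [hg n hn, HahnSeries.ofPowerSeries_apply, HahnSeries.embDomain_of_notMem_range]
      rintro ⟨m, rfl⟩
      simp at hn
      omega
    · obtain ⟨m, rfl⟩ := Int.eq_ofNat_of_zero_le hn
      simp
  · rintro ⟨g, rfl⟩
    refine ⟨HahnSeries.ofPowerSeries ℤ 𝒜 g, fun n hn => ?_, rfl⟩
    rw [HahnSeries.ofPowerSeries_apply, HahnSeries.embDomain_of_notMem_range]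
    rintro ⟨m, rfl⟩
    simp at hn
    omega

/-- `ħ ^ k`, for an integer `k`. -/
def hpow (k : ℤ) : WKB 𝒜 := ofSeries (HahnSeries.single k 1)

theorem hpow_add (k l : ℤ) : (hpow (k + l) : WKB 𝒜) = hpow k * hpow l := by
  simp [hpow, ofSeries, AddMonoidAlgebra.single_mul_single]

theorem hpow_zero : (hpow 0 : WKB 𝒜) = 1 := rfl

theorem hpow_one : (hpow 1 : WKB 𝒜) = hbar := rfl

theorem hpow_neg_one_mul_hbar : (hpow (-1) * hbar : WKB 𝒜) = 1 := by
  rw [← hpow_one, ← hpow_add]; rfl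

theorem hbar_mul_hpow_neg_one : (hbar * hpow (-1) : WKB 𝒜) = 1 := by
  rw [mul_comm, hpow_neg_one_mul_hbar]

theorem hpow_neg_one_mul_neg (f : WKB 𝒜) : hpow (-1) * -(hbar * f) = -f := by
  linear_combination (-f) * hpow_neg_one_mul_hbar (𝒜 := 𝒜)

theorem isBigOh_hpow_mul {f : WKB 𝒜} (hf : IsBigOh 0 f) (k : ℤ) : IsBigOh k (hpow k * f) := by
  obtain ⟨g, hg, rfl⟩ := hf
  refine ⟨HahnSeries.single k 1 * g, fun n hn => ?_, ?_⟩
  · rw [HahnSeries.coeff_single_mul, hg _ (by omega), mul_zero]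
  · rw [hpow, ofSeries, ofSeries, ofSeries, AddMonoidAlgebra.single_mul_single, zero_add]

variable [Algebra ℂ 𝒜]

/-- Without an exponential the term `ħ⁻¹ ∂s` is absent, so a derivation loses no power of `ħ`. -/
theorem isBigOh_zero_wkbDeriv (D : Derivation ℂ 𝒜 𝒜) {f : WKB 𝒜} (hf : IsBigOh 0 f) :
    IsBigOh 0 (wkbDeriv D f) := by
  obtain ⟨g, hg, rfl⟩ := hf
  refine ⟨seriesDeriv D g, fun n hn => ?_, ?_⟩
  · simp [seriesDeriv, hg n hn]
  · rw [ofSeries, wkbDeriv_single]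
    simp [ofSeries]

/-- The operator `f ↦ exp (- s / ħ) * ħ D (f * exp (s / ħ))` on power series in `ħ`. -/
def twist (D : Derivation ℂ 𝒜 𝒜) (s : 𝒜) (f : PowerSeries 𝒜) : PowerSeries 𝒜 :=
  PowerSeries.X * PowerSeries.mk (fun n => D (PowerSeries.coeff n f)) + PowerSeries.C (D s) * f

/-- At `ħ = 0`, the operator `ħ ∂` acts on an amplitude as multiplication by `∂S`; iterated, this
produces the Vandermonde matrix of the semiclassical eigenvalues. -/
theorem constantCoeff_twist (D : Derivation ℂ 𝒜 𝒜) (s : 𝒜) (f : PowerSeries 𝒜) :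
    PowerSeries.constantCoeff (twist D s f) = D s * PowerSeries.constantCoeff f := by
  simp [twist]

theorem constantCoeff_twist_iterate (D : Derivation ℂ 𝒜 𝒜) (s : 𝒜) (f : PowerSeries 𝒜) (i : ℕ) :
    PowerSeries.constantCoeff ((twist D s)^[i] f) = D s ^ i * PowerSeries.constantCoeff f := by
  induction i with
  | zero => simp
  | succ i ih => rw [Function.iterate_succ_apply', constantCoeff_twist, ih]; ring

theorem seriesDeriv_ofPowerSeries (D : Derivation ℂ 𝒜 𝒜) (f : PowerSeries 𝒜) :
    seriesDeriv D (HahnSeries.ofPowerSeries ℤ 𝒜 f) =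
      HahnSeries.ofPowerSeries ℤ 𝒜 (PowerSeries.mk fun n => D (PowerSeries.coeff n f)) := by
  ext n
  change D ((HahnSeries.ofPowerSeries ℤ 𝒜 f).coeff n) = _
  obtain hn | hn := lt_or_ge n 0
  · rw [HahnSeries.ofPowerSeries_apply, HahnSeries.ofPowerSeries_apply,
      HahnSeries.embDomain_of_notMem_range, HahnSeries.embDomain_of_notMem_range, map_zero] <;>
    · rintro ⟨m, rfl⟩
      simp at hn
      omega
  · obtain ⟨m, rfl⟩ := Int.eq_ofNat_of_zero_le hn
    erw [HahnSeries.ofPowerSeries_apply_coeff, HahnSeries.ofPowerSeries_apply_coeff]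
    simp

theorem hbar_mul_wkbDeriv_single (D : Derivation ℂ 𝒜 𝒜) (s : 𝒜) (f : PowerSeries 𝒜) :
    (hbar * wkbDeriv D (AddMonoidAlgebra.single s (HahnSeries.ofPowerSeries ℤ 𝒜 f)) : WKB 𝒜) =
      AddMonoidAlgebra.single s (HahnSeries.ofPowerSeries ℤ 𝒜 (twist D s f)) := by
  rw [wkbDeriv_single, hbar, ofSeries, AddMonoidAlgebra.single_mul_single, zero_add, twist]
  congr 1
  rw [map_add, map_mul, map_mul, HahnSeries.ofPowerSeries_X, HahnSeries.ofPowerSeries_C,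
    seriesDeriv_ofPowerSeries, mul_add, ← mul_assoc, HahnSeries.single_mul_single]
  simp [HahnSeries.C_apply]

end Series

/-! ### Companion matrices -/

section Companion

variable {R : Type*} [CommRing R] {q : ℕ}

/-- The companion matrix with last row `c`. -/
def companion (c : Fin q → R) : Matrix (Fin q) (Fin q) R :=
  Matrix.of fun i l => if (i : ℕ) + 1 = q then c l else if (l : ℕ) = i + 1 then 1 else 0

theorem companion_mul_apply_of_lt (c : Fin q → R) (A : Matrix (Fin q) (Fin q) R) (i n : Fin q)
    (hi : (i : ℕ) + 1 < q) : (companion c * A) i n = A ⟨i + 1, hi⟩ n := by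
  rw [Matrix.mul_apply, Finset.sum_eq_single ⟨i + 1, hi⟩]
  · simp [companion, hi.ne]
  · intro l _ hl
    have : (l : ℕ) ≠ i + 1 := fun h => hl (Fin.ext h)
    simp [companion, hi.ne, this]
  · simp

theorem companion_mul_apply_of_eq (c : Fin q → R) (A : Matrix (Fin q) (Fin q) R) (i n : Fin q)
    (hi : (i : ℕ) + 1 = q) : (companion c * A) i n = ∑ l, c l * A l n := by
  rw [Matrix.mul_apply]
  simp [companion, hi]

theorem mul_companion_apply (c : Fin q → R) (A : Matrix (Fin q) (Fin q) R) (i n e : Fin q)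
    (he : (e : ℕ) + 1 = q) : (A * companion c) i n =
      (if h : 0 < (n : ℕ) then A i ⟨n - 1, by omega⟩ else 0) + A i e * c n := by
  rw [Matrix.mul_apply, ← Finset.add_sum_erase _ _ (Finset.mem_univ e), add_comm]
  congr 1
  · have hl : ∀ l ∈ Finset.univ.erase e, A i l * companion c l n =
        if (n : ℕ) = l + 1 then A i l else 0 := by
      intro l hl
      have h1 : (l : ℕ) + 1 ≠ q := fun h => Finset.ne_of_mem_erase hl (Fin.ext (by omega))
      simp [companion, h1]
    rw [Finset.sum_congr rfl hl]
    split_ifs with h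
    · rw [Finset.sum_eq_single ⟨n - 1, by omega⟩]
      · rw [if_pos]
        simp only
        omega
      · intro l _ hl
        rw [if_neg]
        intro h2
        exact hl (Fin.ext (by simp only; omega))
      · intro h2
        exfalso
        apply h2
        rw [Finset.mem_erase]
        refine ⟨fun h3 => ?_, Finset.mem_univ _⟩
        have h4 := congrArg Fin.val h3
        simp only at h4
        omega
    · exact Finset.sum_eq_zero fun l _ => if_neg (by omega)
  · simp [companion, he]

end Companion

/-! ### Rational functions -/

namespace FunctionAlgebra

variable {𝒜 : Type*} [CommRing 𝒜] [Algebra ℂ 𝒜] (F : FunctionAlgebra 𝒜)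

theorem ratW_eq (r : RatFun) : F.ratW r = ofPS (PowerSeries.C (F.rat r)) := by
  rw [ofPS_apply, HahnSeries.ofPowerSeries_C]; rfl

theorem ratW_mul (r s : RatFun) : F.ratW (r * s) = F.ratW r * F.ratW s := by
  simp [ratW_eq]

theorem ratW_sub (r s : RatFun) : F.ratW (r - s) = F.ratW r - F.ratW s := by
  simp [ratW_eq]

theorem ratW_neg (r : RatFun) : F.ratW (-r) = -F.ratW r := by
  simp [ratW_eq]

theorem ratW_one : F.ratW 1 = 1 := by
  simp [ratW_eq]

theorem coord_injective : Function.Injective coord := fun _ _ h =>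
  MvPolynomial.X_injective (IsFractionRing.injective (MvPolynomial ℕ ℂ) RatFun h)

theorem coord_sub_ne_zero {i j : ℕ} (h : i ≠ j) : coord i - coord j ≠ 0 :=
  sub_ne_zero.2 fun hij => h (coord_injective hij)

theorem ratW_inv_mul {i j : ℕ} (h : i ≠ j) :
    F.ratW (coord i - coord j)⁻¹ * (F.ratW (coord i) - F.ratW (coord j)) = 1 := by
  rw [← ratW_sub, ← ratW_mul, inv_mul_cancel₀ (coord_sub_ne_zero h), ratW_one]

theorem derivOn_wkbDeriv (D : Derivation ℂ 𝒜 𝒜) : DerivOn (⊤ : Subring (WKB 𝒜)) (wkbDeriv D) :=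
  ⟨fun f _ g _ => map_add _ f g, fun f _ g _ => wkbDeriv_mul D f g⟩

theorem derivOn_hDt : DerivOn (⊤ : Subring (WKB 𝒜)) F.hDt :=
  ⟨fun f _ g _ => by simp only [hDt, Dt, map_add, mul_add],
    fun f _ g _ => by simp only [hDt, Dt, wkbDeriv_mul]; ring⟩

theorem Dt_ratW_coord (j : ℕ) : F.Dt (F.ratW (coord j)) = 0 := by
  rw [Dt, ratW, ofCoef, ofSeries, wkbDeriv_single, map_zero, map_zero, zero_mul, add_zero]
  have : seriesDeriv F.dt (HahnSeries.single 0 (F.rat (coord j))) = 0 := by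
    ext n
    change F.dt ((HahnSeries.single (0 : ℤ) (F.rat (coord j))).coeff n) = 0
    rw [HahnSeries.coeff_single]
    split_ifs
    · exact F.dt_coord j
    · exact map_zero _
  rw [this, AddMonoidAlgebra.single_zero]

/-- Only `∂_t x_j = 0` is given; the inverse is reached by differentiating its defining relation. -/
theorem Dt_ratW_inv {i j : ℕ} (h : i ≠ j) : F.Dt (F.ratW (coord i - coord j)⁻¹) = 0 := by
  have h1 := F.ratW_inv_mul h
  have h2 := congrArg F.Dt h1
  rw [Dt, wkbDeriv_mul, (derivOn_wkbDeriv F.dt).one, map_sub] at h2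
  have h3 := F.Dt_ratW_coord i
  have h4 := F.Dt_ratW_coord j
  rw [Dt] at h3 h4 ⊢
  rw [h3, h4] at h2
  linear_combination (F.ratW (coord i - coord j)⁻¹) * h2 -
    wkbDeriv F.dt (F.ratW (coord i - coord j)⁻¹) * h1

theorem hDt_iterate_single (s : 𝒜) (f : PowerSeries 𝒜) (i : ℕ) :
    F.hDt^[i] (AddMonoidAlgebra.single s (HahnSeries.ofPowerSeries ℤ 𝒜 f)) =
      AddMonoidAlgebra.single s (HahnSeries.ofPowerSeries ℤ 𝒜 ((twist F.dt s)^[i] f)) := by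
  induction i with
  | zero => rfl
  | succ i ih =>
    rw [Function.iterate_succ_apply', ih, Function.iterate_succ_apply', hDt, Dt,
      hbar_mul_wkbDeriv_single]

end FunctionAlgebra

namespace Reduction

variable {𝒜 : Type*} [CommRing 𝒜] [Algebra ℂ 𝒜] {F : FunctionAlgebra 𝒜} {q : ℕ}
  (κ : Reduction F q)

/-! ### The linear system -/

/-- The last row of the Lax matrix at `x_j`. -/
def coef (j : ℕ) (l : Fin q) : PowerSeries 𝒜 :=
  (if (l : ℕ) = 0 then PowerSeries.C (F.rat (coord j)) else 0) - κ.u l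

/-- The Lax matrix at `x_j`. -/
def lax (j : ℕ) : Matrix (Fin q) (Fin q) (WKB 𝒜) := companion fun l => ofPS (κ.coef j l)

/-- The matrix `Ψ(x_j)` without its exponential factors. -/
def ampMatrix (j : ℕ) : Matrix (Fin q) (Fin q) (PowerSeries 𝒜) :=
  Matrix.of fun i a => (twist F.dt (κ.act j a))^[(i : ℕ)] (κ.amp j a)

theorem Psi_apply (j : ℕ) (i a : Fin q) : κ.Psi j i a =
    AddMonoidAlgebra.single (κ.act j a) (HahnSeries.ofPowerSeries ℤ 𝒜 (κ.ampMatrix j i a)) :=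
  F.hDt_iterate_single _ _ _

/-- The exponential factors of `Ψ(x_j)`. -/
def expMatrix (j : ℕ) : Matrix (Fin q) (Fin q) (WKB 𝒜) :=
  Matrix.diagonal fun a => AddMonoidAlgebra.single (κ.act j a) 1

theorem Psi_eq (j : ℕ) : κ.Psi j = (κ.ampMatrix j).map ofPS * κ.expMatrix j := by
  ext1 i a
  rw [Psi_apply, expMatrix, Matrix.mul_diagonal, single_ofPowerSeries, Matrix.map_apply]

theorem map_constantCoeff_ampMatrix (j : ℕ) :
    (κ.ampMatrix j).map PowerSeries.constantCoeff =
      (Matrix.vandermonde fun a => F.dt (κ.act j a)).transpose *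
        Matrix.diagonal fun a => PowerSeries.constantCoeff (κ.amp j a) := by
  ext i a
  rw [Matrix.mul_diagonal, Matrix.map_apply, ampMatrix, Matrix.of_apply,
    constantCoeff_twist_iterate, Matrix.transpose_apply, Matrix.vandermonde_apply]

theorem isUnit_det_map_ampMatrix (j : ℕ) :
    IsUnit ((κ.ampMatrix j).map PowerSeries.constantCoeff).det := by
  rw [map_constantCoeff_ampMatrix, Matrix.det_mul, Matrix.det_transpose, Matrix.det_diagonal,
    Matrix.det_vandermonde]
  refine IsUnit.mul ?_ ?_
  · refine IsUnit.prod_univ_iff.2 fun a => IsUnit.prod_iff.2 fun b hb => ?_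
    exact κ.eigenvalues_distinct j b a (Finset.mem_Ioi.1 hb).ne'
  · exact IsUnit.prod_univ_iff.2 fun a => κ.amp_unit j a

/-- A power series is a unit as soon as its constant term is, so the Vandermonde computation at `ħ =
0` suffices. -/
theorem isUnit_det_ampMatrix (j : ℕ) : IsUnit (κ.ampMatrix j).det := by
  rw [PowerSeries.isUnit_iff_constantCoeff]
  have h := RingHom.map_det (PowerSeries.constantCoeff (R := 𝒜)) (κ.ampMatrix j)
  rw [h]
  exact κ.isUnit_det_map_ampMatrix j

theorem isUnit_det_expMatrix (j : ℕ) : IsUnit (κ.expMatrix j).det := by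
  rw [expMatrix, Matrix.det_diagonal]
  refine IsUnit.prod_univ_iff.2 fun a => IsUnit.of_mul_eq_one
    (AddMonoidAlgebra.single (-κ.act j a) 1) ?_
  rw [AddMonoidAlgebra.single_mul_single, add_neg_cancel, one_mul]
  rfl

theorem isUnit_det_map_ofPS (j : ℕ) : IsUnit ((κ.ampMatrix j).map ofPS).det := by
  have h := RingHom.map_det (ofPS (𝒜 := 𝒜)) (κ.ampMatrix j)
  exact h ▸ (κ.isUnit_det_ampMatrix j).map ofPS

theorem isUnit_det_Psi (j : ℕ) : IsUnit (κ.Psi j).det := by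
  rw [Psi_eq, Matrix.det_mul]
  exact (κ.isUnit_det_map_ofPS j).mul (κ.isUnit_det_expMatrix j)

theorem map_ofPS_inv (j : ℕ) : ((κ.ampMatrix j).map ofPS)⁻¹ = ((κ.ampMatrix j)⁻¹).map ofPS := by
  refine Matrix.inv_eq_right_inv ?_
  rw [← Matrix.map_mul, Matrix.mul_nonsing_inv _ (κ.isUnit_det_ampMatrix j)]
  simp

/-- The projector as a matrix of power series in `ħ`. -/
def projPS (j : ℕ) (a : Fin q) : Matrix (Fin q) (Fin q) (PowerSeries 𝒜) :=
  κ.ampMatrix j * Matrix.single a a 1 * (κ.ampMatrix j)⁻¹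

/-- The diagonal matrix of exponentials commutes with `E_a` and cancels in the conjugation, leaving
amplitudes that are power series in `ħ`. -/
theorem P_eq_map (j : ℕ) (a : Fin q) : κ.P j a = (κ.projPS j a).map ofPS := by
  have hs : (Matrix.single a a 1 : Matrix (Fin q) (Fin q) (WKB 𝒜)) =
      (Matrix.single a a (1 : PowerSeries 𝒜)).map ofPS := by
    ext i k
    simp only [Matrix.single_apply, Matrix.map_apply]
    split_ifs <;> simp
  have hc : κ.expMatrix j * Matrix.single a a 1 * (κ.expMatrix j)⁻¹ = Matrix.single a a 1 := by
    have : κ.expMatrix j * Matrix.single a a 1 = Matrix.single a a 1 * κ.expMatrix j := by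
      ext i k
      rw [expMatrix, Matrix.diagonal_mul, Matrix.mul_diagonal, Matrix.single_apply]
      split_ifs with h
      · rw [← h.1, ← h.2, mul_comm]
      · simp
    rw [this, Matrix.mul_assoc, Matrix.mul_nonsing_inv _ (κ.isUnit_det_expMatrix j),
      Matrix.mul_one]
  rw [P, Psi_eq, Matrix.mul_inv_rev, projPS, Matrix.map_mul, Matrix.map_mul, ← map_ofPS_inv, ← hs]
  calc _ = (κ.ampMatrix j).map ofPS * (κ.expMatrix j * Matrix.single a a 1 * (κ.expMatrix j)⁻¹) *
        ((κ.ampMatrix j).map ofPS)⁻¹ := by simp only [Matrix.mul_assoc]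
    _ = _ := by rw [hc]

theorem isBigOh_zero_P (j : ℕ) (a i k : Fin q) : IsBigOh 0 (κ.P j a i k) :=
  isBigOh_zero_iff.2 ⟨κ.projPS j a i k, by rw [P_eq_map]; rfl⟩

/-- The linear system `ħ ∂_t Ψ = L Ψ`. -/
theorem map_hDt_Psi (j : ℕ) : (κ.Psi j).map F.hDt = κ.lax j * κ.Psi j := by
  ext1 i a
  obtain hi | hi := (show (i : ℕ) + 1 ≤ q from i.2).lt_or_eq
  · rw [lax, companion_mul_apply_of_lt _ _ _ _ hi, Matrix.map_apply, Psi, Matrix.of_apply,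
      Matrix.of_apply, Function.iterate_succ_apply']
  · rw [lax, companion_mul_apply_of_eq _ _ _ _ hi, Matrix.map_apply, Psi, Matrix.of_apply,
      ← Function.iterate_succ_apply' F.hDt, Nat.succ_eq_add_one, hi]
    -- All rows but the last are shifts by definition of `Ψ`; the last one is `Q ψ = x ψ` solved for
    -- `(ħ ∂_t)^q ψ`.
    have h := κ.equation j a
    rw [opQ] at h
    rw [eq_sub_of_add_eq h]
    simp only [coef, map_sub, sub_mul, Finset.sum_sub_distrib, Matrix.of_apply]
    congr 1
    rw [Finset.sum_eq_single ⟨0, by omega⟩]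
    · simp [FunctionAlgebra.ratW_eq]
    · intro l _ hl
      have : (l : ℕ) ≠ 0 := fun h => hl (Fin.ext h)
      simp [this]
    · simp

theorem lax_eq_map (j : ℕ) : κ.lax j = (companion (κ.coef j)).map ofPS := by
  ext1 i l
  simp only [lax, companion, Matrix.of_apply, Matrix.map_apply]
  split_ifs <;> simp

/-- The linear system in terms of the amplitudes. -/
theorem companion_mul_ampMatrix (j : ℕ) (i a : Fin q) :
    (companion (κ.coef j) * κ.ampMatrix j) i a =
      twist F.dt (κ.act j a) (κ.ampMatrix j i a) := by
  have h : (κ.Psi j).map F.hDt i a = (κ.lax j * κ.Psi j) i a := by rw [map_hDt_Psi]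
  rw [Matrix.map_apply, Psi_apply, FunctionAlgebra.hDt, FunctionAlgebra.Dt,
    hbar_mul_wkbDeriv_single, lax_eq_map, Psi_eq, ← Matrix.mul_assoc, ← Matrix.map_mul, expMatrix,
    Matrix.mul_diagonal, Matrix.map_apply, ← single_ofPowerSeries] at h
  exact (single_ofPowerSeries_injective _ h).symm

/-- `ħ ∂_t P = [L, P]`. -/
theorem map_hDt_P (j : ℕ) (a : Fin q) :
    (κ.P j a).map F.hDt = κ.lax j * κ.P j a - κ.P j a * κ.lax j :=
  F.derivOn_hDt.map_conj_single (κ.isUnit_det_Psi j) (fun _ _ => trivial) (fun _ _ => trivial)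
    (κ.map_hDt_Psi j) a

theorem P_mul_P (j : ℕ) (a : Fin q) : κ.P j a * κ.P j a = κ.P j a := by
  rw [P]
  calc _ = κ.Psi j * Matrix.single a a 1 * ((κ.Psi j)⁻¹ * κ.Psi j) * Matrix.single a a 1 *
        (κ.Psi j)⁻¹ := by simp only [Matrix.mul_assoc]
    _ = _ := by
      rw [Matrix.nonsing_inv_mul _ (κ.isUnit_det_Psi j), Matrix.mul_one, Matrix.mul_assoc (κ.Psi j),
        Matrix.single_mul_single_same, mul_one]

/-- A matrix of power series that commutes with `L` and satisfies `Y = Y P + P Y` up to `O(ħ)` is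
`O(ħ)`. -/
theorem map_constantCoeff_eq_zero (j : ℕ) (a : Fin q) (Y : Matrix (Fin q) (Fin q) 𝒜)
    (hL : (companion (κ.coef j)).map PowerSeries.constantCoeff * Y =
      Y * (companion (κ.coef j)).map PowerSeries.constantCoeff)
    (hP : Y * (κ.projPS j a).map PowerSeries.constantCoeff +
      (κ.projPS j a).map PowerSeries.constantCoeff * Y = Y) : Y = 0 := by
  set M := (κ.ampMatrix j).map PowerSeries.constantCoeff with hM
  set N := ((κ.ampMatrix j)⁻¹).map PowerSeries.constantCoeff with hN
  set L := (companion (κ.coef j)).map PowerSeries.constantCoeff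
  have hMN : M * N = 1 := by
    rw [hM, hN, ← Matrix.map_mul, Matrix.mul_nonsing_inv _ (κ.isUnit_det_ampMatrix j)]
    exact Matrix.map_one _ (map_zero _) (map_one _)
  have hNM : N * M = 1 := mul_eq_one_comm.1 hMN
  -- At `ħ = 0` the columns of the amplitude matrix are eigenvectors of `L`, with eigenvalues `∂_t
  -- S_b`.
  have hLM : L * M = M * Matrix.diagonal fun b => F.dt (κ.act j b) := by
    rw [← Matrix.map_mul]
    ext i b
    rw [Matrix.map_apply, companion_mul_ampMatrix, constantCoeff_twist, Matrix.mul_diagonal,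
      mul_comm]
    rfl
  have hPM : (κ.projPS j a).map PowerSeries.constantCoeff = M * Matrix.single a a 1 * N := by
    rw [projPS, Matrix.map_mul, Matrix.map_mul]
    congr 2
    ext i k
    simp only [Matrix.single_apply, Matrix.map_apply]
    split_ifs <;> simp
  rw [hPM] at hP
  set Z := Matrix.diagonal fun b => F.dt (κ.act j b)
  set W := N * Y * M with hW
  have hNL : N * L = Z * N := by
    calc N * L = N * (L * M) * N := by
          rw [Matrix.mul_assoc, Matrix.mul_assoc L, hMN, Matrix.mul_one]
      _ = _ := by rw [hLM, ← Matrix.mul_assoc, hNM, Matrix.one_mul]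
  have hZW : Z * W = W * Z := by
    calc Z * W = (Z * N) * Y * M := by simp only [hW, Matrix.mul_assoc]
      _ = N * (L * Y) * M := by rw [← hNL]; simp only [Matrix.mul_assoc]
      _ = N * Y * (L * M) := by rw [hL]; simp only [Matrix.mul_assoc]
      _ = W * Z := by rw [hLM]; simp only [hW, Matrix.mul_assoc]
  have hEW : W * Matrix.single a a 1 + Matrix.single a a 1 * W = W := by
    calc W * Matrix.single a a 1 + Matrix.single a a 1 * W =
        N * Y * M * Matrix.single a a 1 * (N * M) +
          (N * M) * Matrix.single a a 1 * (N * Y * M) := by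
          rw [hNM, Matrix.mul_one, Matrix.one_mul]
      _ = N * (Y * (M * Matrix.single a a 1 * N) + M * Matrix.single a a 1 * N * Y) * M := by
          simp only [Matrix.mul_add, Matrix.add_mul, Matrix.mul_assoc]
      _ = W := by rw [hP]
  -- In the eigenbasis: off-diagonal entries die by commutation with the eigenvalues, the diagonal
  -- entry at `a` satisfies `2w = w`, and the other diagonal entries satisfy `0 = w`.
  have hW0 : W = 0 := by
    ext b c
    obtain rfl | hbc := eq_or_ne b c
    · have h := congrFun (congrFun hEW b) b
      obtain rfl | hab := eq_or_ne a b
      · simpa using h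
      · simpa [Matrix.add_apply, hab, hab.symm] using h.symm
    · have h := congrFun (congrFun hZW b) c
      rw [Matrix.diagonal_mul, Matrix.mul_diagonal] at h
      have h2 : (F.dt (κ.act j b) - F.dt (κ.act j c)) * W b c = 0 := by linear_combination h
      exact (κ.eigenvalues_distinct j b c hbc).mul_right_eq_zero.1 h2
  calc Y = M * N * Y * (M * N) := by rw [hMN, Matrix.one_mul, Matrix.mul_one]
    _ = M * W * N := by simp only [hW, Matrix.mul_assoc]
    _ = 0 := by rw [hW0, Matrix.mul_zero, Matrix.zero_mul]

end Reduction

namespace Reduction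

variable {𝒜 : Type*} [CommRing 𝒜] [Algebra ℂ 𝒜] {F : FunctionAlgebra 𝒜} {q : ℕ}
  (κ : Reduction F q)

/-! ### The rings of functions of given points -/

theorem pointRing_mono {S S' : Set ℕ} (h : S ⊆ S') : κ.pointRing S ≤ κ.pointRing S' :=
  sInf_le_sInf fun _ hT => ⟨hT.1,
    fun r hr => hT.2.1 r (IntermediateField.adjoin.mono ℂ _ _ (Set.image_mono h) hr),
    fun j hj => hT.2.2.1 j (h hj), hT.2.2.2.1, fun i hi => hT.2.2.2.2 i (h hi)⟩

theorem ofSeries_mem_pointRing (S : Set ℕ) {f : LaurentSeries 𝒜}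
    (hf : ∀ n, f.coeff n ∈ Set.range (algebraMap ℂ 𝒜)) : ofSeries f ∈ κ.pointRing S :=
  Subring.mem_sInf.2 fun _ hT => hT.1 f hf

theorem ratW_mem_pointRing {S : Set ℕ} {r : RatFun} (hr : r ∈ ratIn S) :
    F.ratW r ∈ κ.pointRing S :=
  Subring.mem_sInf.2 fun _ hT => hT.2.1 r hr

theorem Psi_mem_pointRing {S : Set ℕ} {j : ℕ} (hj : j ∈ S) (i a : Fin q) :
    κ.Psi j i a ∈ κ.pointRing S :=
  Subring.mem_sInf.2 fun _ hT => (hT.2.2.1 j hj).1 i a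

theorem inv_Psi_mem_pointRing {S : Set ℕ} {j : ℕ} (hj : j ∈ S) (i a : Fin q) :
    (κ.Psi j)⁻¹ i a ∈ κ.pointRing S := by
  rw [Matrix.inv_def, Matrix.smul_apply, smul_eq_mul]
  exact Subring.mul_mem _ (Subring.mem_sInf.2 fun _ hT => (hT.2.2.1 j hj).2)
    (adjugate_mem (κ.Psi_mem_pointRing hj) i a)

theorem Dt_mem_pointRing {S : Set ℕ} {f : WKB 𝒜} (hf : f ∈ κ.pointRing S) :
    F.Dt f ∈ κ.pointRing S :=
  Subring.mem_sInf.2 fun T hT => hT.2.2.2.1 f (Subring.mem_sInf.1 hf T hT)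

theorem coeff_single_one_mem (k n : ℤ) :
    (HahnSeries.single k 1 : LaurentSeries 𝒜).coeff n ∈ Set.range (algebraMap ℂ 𝒜) := by
  rw [HahnSeries.coeff_single]
  split_ifs
  · exact ⟨1, map_one _⟩
  · exact ⟨0, map_zero _⟩

theorem hpow_mem_pointRing (S : Set ℕ) (k : ℤ) : hpow k ∈ κ.pointRing S :=
  κ.ofSeries_mem_pointRing S (coeff_single_one_mem k)

theorem hDt_mem_pointRing {S : Set ℕ} {f : WKB 𝒜} (hf : f ∈ κ.pointRing S) :
    F.hDt f ∈ κ.pointRing S :=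
  Subring.mul_mem _ (κ.hpow_mem_pointRing S 1) (κ.Dt_mem_pointRing hf)

theorem P_mem_pointRing {S : Set ℕ} {j : ℕ} (hj : j ∈ S) (a i k : Fin q) :
    κ.P j a i k ∈ κ.pointRing S := by
  refine matrix_mul_mem (matrix_mul_mem (κ.Psi_mem_pointRing hj) fun i k => ?_)
    (κ.inv_Psi_mem_pointRing hj) i k
  rw [Matrix.single_apply]
  split_ifs
  · exact Subring.one_mem _
  · exact Subring.zero_mem _

/-- Holds because `L = (ħ ∂_t Ψ) Ψ⁻¹`. -/
theorem lax_mem_pointRing {S : Set ℕ} {j : ℕ} (hj : j ∈ S) (i k : Fin q) :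
    κ.lax j i k ∈ κ.pointRing S := by
  have h : κ.lax j = (κ.Psi j).map F.hDt * (κ.Psi j)⁻¹ := by
    rw [map_hDt_Psi, Matrix.mul_assoc, Matrix.mul_nonsing_inv _ (κ.isUnit_det_Psi j),
      Matrix.mul_one]
  rw [h]
  exact matrix_mul_mem (fun i a => κ.hDt_mem_pointRing (κ.Psi_mem_pointRing hj i a))
    (κ.inv_Psi_mem_pointRing hj) i k

theorem coord_mem_ratIn {S : Set ℕ} {j : ℕ} (hj : j ∈ S) : coord j ∈ ratIn S :=
  IntermediateField.subset_adjoin _ _ ⟨j, hj, rfl⟩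

theorem ratIn_mono {S S' : Set ℕ} (h : S ⊆ S') : ratIn S ≤ ratIn S' :=
  IntermediateField.adjoin.mono ℂ _ _ (Set.image_mono h)

theorem ofPS_coef (j : ℕ) (l : Fin q) : ofPS (κ.coef j l) =
    (if (l : ℕ) = 0 then F.ratW (coord j) else 0) - ofPS (κ.u l) := by
  rw [coef, map_sub, FunctionAlgebra.ratW_eq]
  split_ifs <;> simp

theorem ofPS_coef_mem_pointRing {S : Set ℕ} {j : ℕ} (hj : j ∈ S) (l : Fin q) :
    ofPS (κ.coef j l) ∈ κ.pointRing S := by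
  have hq : q - 1 + 1 = q := by have := l.2; omega
  have h := κ.lax_mem_pointRing hj ⟨q - 1, by omega⟩ l
  simpa [lax, companion, hq] using h

/-- The `u_l` depend on no point, but they are reached through the Lax matrix at some point; hence
`S` must contain one. -/
theorem ofPS_u_mem_pointRing {S : Set ℕ} {j : ℕ} (hj : j ∈ S) (l : Fin q) :
    ofPS (κ.u l) ∈ κ.pointRing S := by
  have h : ofPS (κ.u l) =
      (if (l : ℕ) = 0 then F.ratW (coord j) else 0) - ofPS (κ.coef j l) := by
    rw [ofPS_coef]; ring
  rw [h]
  refine Subring.sub_mem _ ?_ (κ.ofPS_coef_mem_pointRing hj l)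
  split_ifs
  · exact κ.ratW_mem_pointRing (coord_mem_ratIn hj)
  · exact Subring.zero_mem _

theorem Dt_hpow_mul (k : ℤ) (f : WKB 𝒜) : F.Dt (hpow k * f) = hpow k * F.Dt f := by
  have h : F.Dt (hpow k) = 0 := by
    rw [FunctionAlgebra.Dt, hpow, ofSeries, wkbDeriv_single, map_zero, map_zero, zero_mul, add_zero]
    have : seriesDeriv F.dt (HahnSeries.single k 1) = 0 := by
      ext n
      change F.dt ((HahnSeries.single k (1 : 𝒜)).coeff n) = 0
      rw [HahnSeries.coeff_single]
      split_ifs <;> simp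
    rw [this, AddMonoidAlgebra.single_zero]
  rw [FunctionAlgebra.Dt] at h ⊢
  rw [wkbDeriv_mul, h, mul_zero, add_zero]

namespace InsertionOperator

variable {κ} (δ : κ.InsertionOperator)

theorem derivOn_app (j : ℕ) (a : Fin q) : DerivOn (κ.pointRing {j}ᶜ) (δ.app j a) := by
  constructor
  · intro f hf g hg
    simp only [app, applyDer, dif_pos hf, dif_pos hg, dif_pos (Subring.add_mem _ hf hg)]
    exact map_add (δ.der j a) ⟨f, hf⟩ ⟨g, hg⟩
  · intro f hf g hg
    simp only [app, applyDer, dif_pos hf, dif_pos hg, dif_pos (Subring.mul_mem _ hf hg)]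
    exact (δ.der j a).leibniz ⟨f, hf⟩ ⟨g, hg⟩

theorem app_hpow_mul (j : ℕ) (a : Fin q) (k : ℤ) {f : WKB 𝒜} (hf : f ∈ κ.pointRing {j}ᶜ) :
    δ.app j a (hpow k * f) = hpow k * δ.app j a f := by
  have h : δ.app j a (hpow k) = 0 := δ.der_const j a _ (coeff_single_one_mem k)
  rw [(δ.derivOn_app j a).mul _ (κ.hpow_mem_pointRing _ k) _ hf, h, mul_zero, add_zero]

theorem pointRing_le {j : ℕ} {S : Set ℕ} (hj : j ∉ S) : κ.pointRing S ≤ κ.pointRing {j}ᶜ :=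
  κ.pointRing_mono (Set.subset_compl_singleton_iff.2 hj)

/-! ### Functions such that `k` insertions are of order `ħ ^ k` -/

/-- Functions of the points in `S` such that every insertion produces a factor `ħ`, up to `k`
insertions. -/
def Good : ℕ → Set ℕ → WKB 𝒜 → Prop
  | 0, S, f => f ∈ κ.pointRing S ∧ IsBigOh 0 f
  | k + 1, S, f => Good k S f ∧
      ∀ j ∉ S, ∀ a, Good k (insert j S) (hpow (-1) * δ.app j a f)

variable {δ}

theorem Good.of_le {k l : ℕ} (h : k ≤ l) {S : Set ℕ} {f : WKB 𝒜} (hf : δ.Good l S f) :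
    δ.Good k S f := by
  induction l, h using Nat.le_induction with
  | base => exact hf
  | succ l _ ih => exact ih hf.1

theorem Good.zero_level {k : ℕ} {S : Set ℕ} {f : WKB 𝒜} (hf : δ.Good k S f) :
    f ∈ κ.pointRing S ∧ IsBigOh 0 f :=
  hf.of_le (Nat.zero_le k)

theorem Good.mono {k : ℕ} {S S' : Set ℕ} (h : S ⊆ S') {f : WKB 𝒜} (hf : δ.Good k S f) :
    δ.Good k S' f := by
  induction k generalizing S S' f with
  | zero => exact ⟨κ.pointRing_mono h hf.1, hf.2⟩
  | succ k ih =>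
    exact ⟨ih h hf.1, fun j hj a => ih (Set.insert_subset_insert h) (hf.2 j (fun h' => hj (h h')) a)⟩

theorem good_of_app_eq_zero {k : ℕ} {S : Set ℕ} {f : WKB 𝒜} (hS : f ∈ κ.pointRing S)
    (hf : IsBigOh 0 f) (h : ∀ j ∉ S, ∀ a, δ.app j a f = 0) : δ.Good k S f := by
  have h0 : ∀ k S, δ.Good k S 0 := by
    intro k
    induction k with
    | zero => exact fun S => ⟨Subring.zero_mem _, isBigOh_zero_iff.2 ⟨0, (map_zero _).symm⟩⟩
    | succ k ih =>
      exact fun S => ⟨ih S, fun j _ a => by rw [(δ.derivOn_app j a).zero, mul_zero]; exact ih _⟩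
  induction k with
  | zero => exact ⟨hS, hf⟩
  | succ k ih => exact ⟨ih, fun j hj a => by rw [h j hj a, mul_zero]; exact h0 _ _⟩

theorem good_ofSeries {k : ℕ} {S : Set ℕ} {f : LaurentSeries 𝒜}
    (hf : ∀ n, f.coeff n ∈ Set.range (algebraMap ℂ 𝒜)) (hf' : ∀ n < 0, f.coeff n = 0) :
    δ.Good k S (ofSeries f) :=
  good_of_app_eq_zero (κ.ofSeries_mem_pointRing S hf) ⟨f, hf', rfl⟩
    fun j _ a => δ.der_const j a f hf

theorem good_ratW {k : ℕ} {S : Set ℕ} {r : RatFun} (hr : r ∈ ratIn S) :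
    δ.Good k S (F.ratW r) :=
  good_of_app_eq_zero (κ.ratW_mem_pointRing hr)
    (isBigOh_zero_iff.2 ⟨_, F.ratW_eq r⟩)
    fun j hj a => δ.der_rat j a r (ratIn_mono (Set.subset_compl_singleton_iff.2 hj) hr)

theorem good_hbar {k : ℕ} {S : Set ℕ} : δ.Good k S hbar :=
  good_ofSeries (coeff_single_one_mem 1) fun n hn => by
    rw [HahnSeries.coeff_single, if_neg (by omega)]

theorem Good.add {k : ℕ} {S : Set ℕ} {f g : WKB 𝒜} (hf : δ.Good k S f) (hg : δ.Good k S g) :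
    δ.Good k S (f + g) := by
  induction k generalizing S f g with
  | zero =>
    obtain ⟨f', rfl⟩ := isBigOh_zero_iff.1 hf.2
    obtain ⟨g', rfl⟩ := isBigOh_zero_iff.1 hg.2
    exact ⟨Subring.add_mem _ hf.1 hg.1, isBigOh_zero_iff.2 ⟨f' + g', (map_add _ _ _).symm⟩⟩
  | succ k ih =>
    refine ⟨ih hf.1 hg.1, fun j hj a => ?_⟩
    rw [(δ.derivOn_app j a).add _ (pointRing_le hj hf.zero_level.1) _
      (pointRing_le hj hg.zero_level.1), mul_add]
    exact ih (hf.2 j hj a) (hg.2 j hj a)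

/-- By the Leibniz rule the insertion hits one factor, which supplies the `ħ`; the other is kept at
one level lower, over the enlarged set of points. -/
theorem Good.mul {k : ℕ} {S : Set ℕ} {f g : WKB 𝒜} (hf : δ.Good k S f) (hg : δ.Good k S g) :
    δ.Good k S (f * g) := by
  induction k generalizing S f g with
  | zero =>
    obtain ⟨f', rfl⟩ := isBigOh_zero_iff.1 hf.2
    obtain ⟨g', rfl⟩ := isBigOh_zero_iff.1 hg.2
    exact ⟨Subring.mul_mem _ hf.1 hg.1, isBigOh_zero_iff.2 ⟨f' * g', (map_mul _ _ _).symm⟩⟩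
  | succ k ih =>
    refine ⟨ih hf.1 hg.1, fun j hj a => ?_⟩
    rw [(δ.derivOn_app j a).mul _ (pointRing_le hj hf.zero_level.1) _
      (pointRing_le hj hg.zero_level.1), mul_add, mul_left_comm, mul_left_comm _ g]
    exact (ih (hf.1.mono (Set.subset_insert j S)) (hg.2 j hj a)).add
      (ih (hg.1.mono (Set.subset_insert j S)) (hf.2 j hj a))

theorem good_neg_one {k : ℕ} {S : Set ℕ} : δ.Good k S (-1) := by
  have h := good_ratW (δ := δ) (k := k) (S := S) (neg_mem (one_mem (ratIn S)))
  rwa [FunctionAlgebra.ratW_neg, FunctionAlgebra.ratW_one] at h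

variable (δ) in
/-- The functions of the points in `S` such that every insertion produces a factor `ħ`, up to `k`
insertions, form a ring. -/
def goodRing (k : ℕ) (S : Set ℕ) : Subring (WKB 𝒜) where
  carrier := {f | δ.Good k S f}
  mul_mem' hf hg := Good.mul hf hg
  one_mem' := by
    have h := good_ratW (δ := δ) (k := k) (one_mem (ratIn S))
    rwa [FunctionAlgebra.ratW_one] at h
  add_mem' hf hg := Good.add hf hg
  zero_mem' := by
    have h := good_ratW (δ := δ) (k := k) (zero_mem (ratIn S))
    rwa [FunctionAlgebra.ratW_eq, map_zero, map_zero, map_zero] at h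
  neg_mem' {f} hf := by
    have e : -1 * f = -f := by ring
    exact e ▸ Good.mul good_neg_one hf

theorem Good.Dt (hδ : δ.Compatible) {k : ℕ} {S : Set ℕ} {f : WKB 𝒜} (hf : δ.Good k S f) :
    δ.Good k S (F.Dt f) := by
  induction k generalizing S f with
  | zero => exact ⟨κ.Dt_mem_pointRing hf.1, isBigOh_zero_wkbDeriv _ hf.2⟩
  | succ k ih =>
    refine ⟨ih hf.1, fun j hj a => ?_⟩
    rw [hδ j a f (pointRing_le hj hf.zero_level.1), ← Dt_hpow_mul]
    exact ih (hf.2 j hj a)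

/-- Iterated insertions in a good function. -/
theorem Good.iter (l : List (ℕ × Fin q)) {k : ℕ} {S : Set ℕ} {f : WKB 𝒜}
    (hf : δ.Good (k + l.length) S f) (hl : (l.map Prod.fst).Nodup)
    (hS : ∀ i ∈ l.map Prod.fst, i ∉ S) :
    ∃ g, δ.Good k (S ∪ {i | i ∈ l.map Prod.fst}) g ∧ δ.iter l f = hpow l.length * g := by
  induction l generalizing k with
  | nil => exact ⟨f, by simpa using hf, by simp [InsertionOperator.iter, hpow_zero]⟩
  | cons p l ih =>
    rw [List.map_cons, List.nodup_cons] at hl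
    -- One level is kept in reserve for the head of the list, which is inserted last.
    obtain ⟨g, hg, hfg⟩ := ih (k := k + 1)
      (by rw [List.length_cons] at hf; rwa [add_assoc, add_comm 1])
      hl.2 (fun i hi => hS i (List.mem_cons_of_mem _ hi))
    have hp : p.1 ∉ S ∪ {i | i ∈ l.map Prod.fst} := by
      rintro (h | h)
      · exact hS p.1 (by simp) h
      · exact hl.1 h
    refine ⟨hpow (-1) * δ.app p.1 p.2 g, (hg.2 p.1 hp p.2).mono ?_, ?_⟩
    · intro i hi
      simp only [List.map_cons, List.mem_cons, Set.mem_union, Set.mem_ofPred_eq,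
        Set.mem_insert_iff] at hi ⊢
      tauto
    · have h1 : δ.iter (p :: l) f = δ.app p.1 p.2 (δ.iter l f) := rfl
      rw [h1, hfg, δ.app_hpow_mul _ _ _ (pointRing_le hp hg.zero_level.1), ← mul_assoc, ← hpow_add]
      congr 2
      rw [List.length_cons]
      push_cast
      ring

end InsertionOperator

end Reduction

/-! ### The last row of the variation of the Lax matrix -/

section LastRow

variable {R : Type*} [CommRing R] {q : ℕ}

/-- The derivative of a companion matrix with respect to the first entry of its last row. -/
def cornerUnit (R : Type*) [CommRing R] (q : ℕ) : Matrix (Fin q) (Fin q) R :=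
  Matrix.of fun i l => if (i : ℕ) + 1 = q ∧ (l : ℕ) = 0 then 1 else 0

/-- The hypothesis is the entrywise form of `d = [L, p]` away from the last row and first column;
summed over the positions `(s, n + s + 1)`, the differences of `p` telescope. -/
theorem sum_antidiagonal_recursion {q : ℕ} {p d : ℕ → ℕ → R} {c : ℕ → R}
    (h : ∀ i n, i + 1 < q → n + 1 < q → d i (n + 1) = p (i + 1) (n + 1) - p i n -
      p i (q - 1) * c (n + 1)) (m n : ℕ) (hmn : n + m < q) :
    p m (n + m) - p 0 n - ∑ s ∈ Finset.range m, p s (q - 1) * c (n + s + 1) =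
      ∑ s ∈ Finset.range m, d s (n + s + 1) := by
  induction m with
  | zero => simp
  | succ m ih =>
    rw [Finset.sum_range_succ, Finset.sum_range_succ, ← ih (by omega),
      h m (n + m) (by omega) (by omega), ← add_assoc]
    ring

/-- The identity that dictates the shape of `B`: the order-one part of the last row of `δ L` is a
sum of entries of `[L, P] = ħ ∂_t P`, hence gains a factor `ħ`. The two companion matrices belong to
different points, so `c` and `c'` differ only in the entry `0`. -/
theorem last_row_commutator (c c' : Fin q → R) (p b d : Matrix (Fin q) (Fin q) R)
    (hc : ∀ l : Fin q, (l : ℕ) ≠ 0 → c' l = c l)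
    (hd : d = companion c * p - p * companion c)
    (hb : b = Matrix.of fun l n : Fin q =>
      if h : n < l then p ⟨l - n - 1, by omega⟩ ⟨q - 1, by omega⟩ else 0)
    (e n : Fin q) (he : (e : ℕ) + 1 = q) :
    (p * cornerUnit R q - cornerUnit R q * p + b * companion c' - companion c' * b) e n =
      ∑ s : Fin q, if h : (n : ℕ) + s + 1 < q then d s ⟨n + s + 1, h⟩ else 0 := by
  have hq : 0 < q := by omega
  set p' : ℕ → ℕ → R := fun i k => if h : i < q ∧ k < q then p ⟨i, h.1⟩ ⟨k, h.2⟩ else 0 with hp'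
  set d' : ℕ → ℕ → R := fun i k => if h : i < q ∧ k < q then d ⟨i, h.1⟩ ⟨k, h.2⟩ else 0 with hd'
  set c₁ : ℕ → R := fun k => if h : k < q then c ⟨k, h⟩ else 0 with hc₁
  have pe : ∀ i k : Fin q, p i k = p' i k := fun i k => by simp [hp']
  have hrec : ∀ i n, i + 1 < q → n + 1 < q → d' i (n + 1) = p' (i + 1) (n + 1) - p' i n -
      p' i (q - 1) * c₁ (n + 1) := by
    intro i n hi hn
    have h := congrFun (congrFun hd ⟨i, by omega⟩) ⟨n + 1, hn⟩
    rw [Matrix.sub_apply, companion_mul_apply_of_lt _ _ _ _ hi, mul_companion_apply _ _ _ _ e he,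
      dif_pos (by simp)] at h
    have hd1 : d' i (n + 1) = d ⟨i, by omega⟩ ⟨n + 1, hn⟩ := by simp [hd', hn, show i < q by omega]
    have hc1 : c₁ (n + 1) = c ⟨n + 1, hn⟩ := by simp [hc₁, hn]
    have hp1 : p' i (q - 1) = p ⟨i, by omega⟩ e := by
      rw [pe, show (e : ℕ) = q - 1 by omega]
    rw [hd1, h, hc1, hp1, pe, pe]
    simp only [Nat.add_sub_cancel]
    ring
  -- The length `q - 1 - n` is the one that ends in the last column.
  have key := sum_antidiagonal_recursion hrec (q - 1 - n) n (by omega)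
  have hsum : (∑ s : Fin q, if h : (n : ℕ) + s + 1 < q then d s ⟨n + s + 1, h⟩ else 0) =
      ∑ s ∈ Finset.range (q - 1 - n), d' s (n + s + 1) := by
    have h1 : ∀ s : Fin q, (if h : (n : ℕ) + s + 1 < q then d s ⟨n + s + 1, h⟩ else 0) =
        d' s (n + s + 1) := fun s => by simp [hd']
    rw [Finset.sum_congr rfl fun s _ => h1 s, Fin.sum_univ_eq_sum_range (fun s => d' s (n + s + 1)),
      ← Finset.sum_subset (Finset.range_mono (show q - 1 - n ≤ q by omega))]
    intro s _ hs
    rw [Finset.mem_range] at hs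
    simp only [hd']
    rw [dif_neg (by omega)]
  rw [hsum, ← key]
  -- For `n = 0` the entry comes from the corner term and for `n > 0` from the shifted `b`; the zero
  -- diagonal of `b` removes the contribution of `c'`.
  have hPE : (p * cornerUnit R q) e n + (b * companion c') e n = p' (q - 1 - n) (n + (q - 1 - n)) := by
    have hbee : b e e = 0 := by simp [hb]
    rw [mul_companion_apply _ _ _ _ e he, hbee, zero_mul, add_zero, Matrix.mul_apply,
      show (n : ℕ) + (q - 1 - n) = q - 1 by omega]
    split_ifs with h
    · rw [Finset.sum_eq_zero, zero_add, hb, Matrix.of_apply, dif_pos, pe]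
      · congr 1
        simp only
        omega
      · rw [Fin.lt_def]
        simp only
        omega
      · intro l _
        simp [cornerUnit, show (n : ℕ) ≠ 0 by omega]
    · rw [add_zero, Finset.sum_eq_single e, cornerUnit, Matrix.of_apply,
        if_pos ⟨he, by omega⟩, mul_one, pe]
      · congr 1 <;> omega
      · intro l _ hl
        rw [cornerUnit, Matrix.of_apply, if_neg, mul_zero]
        rintro ⟨h1, -⟩
        exact hl (Fin.ext (by omega))
      · simp
  have hEP : (cornerUnit R q * p) e n = p' 0 n := by
    rw [Matrix.mul_apply, Finset.sum_eq_single ⟨0, hq⟩]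
    · simp [cornerUnit, he, pe]
    · intro l _ hl
      have : (l : ℕ) ≠ 0 := fun h => hl (Fin.ext h)
      simp [cornerUnit, this]
    · simp
  have hLB : (companion c' * b) e n =
      ∑ s ∈ Finset.range (q - 1 - n), p' s (q - 1) * c₁ (n + s + 1) := by
    -- Strict lower triangularity of `b` forces `l > n ≥ 0`, where `c'` and `c` agree.
    have h1 : ∀ l : Fin q, c' l * b l n =
        (fun l : ℕ => if (n : ℕ) < l then p' (l - n - 1) (q - 1) * c₁ l else 0) l := by
      intro l
      simp only [hb, Matrix.of_apply, Fin.lt_def]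
      split_ifs with h
      · rw [hc l (by omega), pe]
        simp [hc₁, mul_comm]
      · rw [mul_zero]
    have hr : Finset.range q = Finset.range ((n + 1) + (q - 1 - n)) := by
      congr 1
      omega
    rw [companion_mul_apply_of_eq _ _ _ _ he, Finset.sum_congr rfl fun l _ => h1 l,
      Fin.sum_univ_eq_sum_range
        (fun l : ℕ => if (n : ℕ) < l then p' (l - n - 1) (q - 1) * c₁ l else 0), hr,
      Finset.sum_range_add, Finset.sum_eq_zero, zero_add]
    · refine Finset.sum_congr rfl fun s _ => ?_
      rw [if_pos (by omega), show (n : ℕ) + 1 + s - n - 1 = s by omega,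
        show (n : ℕ) + 1 + s = n + s + 1 by omega]
    · intro s hs
      rw [Finset.mem_range] at hs
      exact if_neg (by omega)
  rw [Matrix.sub_apply, Matrix.add_apply, Matrix.sub_apply, hEP, hLB, ← hPE]
  ring

end LastRow

/-! ### Zero curvature and the insertion in the Lax matrix -/

namespace Reduction

variable {𝒜 : Type*} [CommRing 𝒜] [Algebra ℂ 𝒜] {F : FunctionAlgebra 𝒜} {q : ℕ}
  (κ : Reduction F q)

theorem lax_sub_lax (i j : ℕ) : κ.lax i - κ.lax j =
    (F.ratW (coord i) - F.ratW (coord j)) • cornerUnit (WKB 𝒜) q := by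
  ext1 k l
  simp only [lax, companion, cornerUnit, Matrix.sub_apply, Matrix.of_apply, Matrix.smul_apply,
    ofPS_coef, smul_eq_mul]
  by_cases h1 : (k : ℕ) + 1 = q <;> by_cases h2 : (l : ℕ) = 0 <;> simp [h1, h2]

namespace InsertionOperator

variable {κ} (δ : κ.InsertionOperator)

/-- The matrix `N` such that `δ_y^a Ψ(x) = N Ψ(x)`. -/
def connection (j : ℕ) (a : Fin q) (i : ℕ) : Matrix (Fin q) (Fin q) (WKB 𝒜) :=
  F.ratW (coord i - coord j)⁻¹ • κ.P j a + δ.U j a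

variable {δ}

theorem app_hDt (hδ : δ.Compatible) (j : ℕ) (a : Fin q) {f : WKB 𝒜}
    (hf : f ∈ κ.pointRing {j}ᶜ) : δ.app j a (F.hDt f) = F.hDt (δ.app j a f) := by
  have h := δ.app_hpow_mul j a 1 (κ.Dt_mem_pointRing hf)
  rw [hpow_one] at h
  rw [FunctionAlgebra.hDt, h, hδ j a f hf, FunctionAlgebra.hDt]

theorem map_app_P {i j : ℕ} (hij : i ≠ j) (a b : Fin q) :
    (κ.P i b).map (δ.app j a) =
      δ.connection j a i * κ.P i b - κ.P i b * δ.connection j a i := by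
  have hi : i ∈ ({j}ᶜ : Set ℕ) := hij
  exact (δ.derivOn_app j a).map_conj_single (κ.isUnit_det_Psi i) (κ.Psi_mem_pointRing hi)
    (κ.inv_Psi_mem_pointRing hi) (δ.der_Psi j a i hij) b

/-- The zero curvature equation. -/
theorem map_app_lax (hδ : δ.Compatible) {i j : ℕ} (hij : i ≠ j) (a : Fin q) :
    (κ.lax i).map (δ.app j a) = (δ.connection j a i).map F.hDt +
      δ.connection j a i * κ.lax i - κ.lax i * δ.connection j a i := by
  have hi : i ∈ ({j}ᶜ : Set ℕ) := hij
  have hΨ : (κ.Psi i).map (δ.app j a) = δ.connection j a i * κ.Psi i := δ.der_Psi j a i hij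
  have h1 := (δ.derivOn_app j a).map_matrix_mul (κ.lax_mem_pointRing hi) (κ.Psi_mem_pointRing hi)
  have h2 : ((κ.Psi i).map F.hDt).map (δ.app j a) = ((κ.Psi i).map (δ.app j a)).map F.hDt := by
    ext1 k l
    exact app_hDt hδ j a (κ.Psi_mem_pointRing hi k l)
  rw [← map_hDt_Psi, h2, hΨ, F.derivOn_hDt.map_matrix_mul (fun _ _ => trivial)
    (fun _ _ => trivial), map_hDt_Psi] at h1
  have h3 : (κ.lax i).map (δ.app j a) * κ.Psi i = ((δ.connection j a i).map F.hDt +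
      δ.connection j a i * κ.lax i - κ.lax i * δ.connection j a i) * κ.Psi i := by
    rw [Matrix.sub_mul, Matrix.add_mul, Matrix.mul_assoc _ (κ.lax i), Matrix.mul_assoc (κ.lax i), h1]
    abel
  have h4 := congrArg (· * (κ.Psi i)⁻¹) h3
  simpa only [Matrix.mul_assoc, Matrix.mul_nonsing_inv _ (κ.isUnit_det_Psi i), Matrix.mul_one]
    using h4

/-- The pole at `x_i = x_j` disappears: `ħ ∂_t P(x_j)` cancels the commutator with `L(x_j)`, and
`L(x_i) - L(x_j)` carries the factor `x_i - x_j`. -/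
theorem map_app_lax_eq (hδ : δ.Compatible) {i j : ℕ} (hij : i ≠ j) (a : Fin q) :
    (κ.lax i).map (δ.app j a) =
      κ.P j a * cornerUnit (WKB 𝒜) q - cornerUnit (WKB 𝒜) q * κ.P j a + (δ.U j a).map F.hDt +
        δ.U j a * κ.lax i - κ.lax i * δ.U j a := by
  have h1 : (δ.connection j a i).map F.hDt = F.ratW (coord i - coord j)⁻¹ •
      (κ.lax j * κ.P j a - κ.P j a * κ.lax j) + (δ.U j a).map F.hDt := by
    rw [← map_hDt_P]
    ext1 k l
    simp only [connection, Matrix.map_apply, Matrix.add_apply, Matrix.smul_apply, smul_eq_mul]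
    rw [F.derivOn_hDt.add _ trivial _ trivial, F.derivOn_hDt.mul _ trivial _ trivial,
      FunctionAlgebra.hDt, FunctionAlgebra.hDt, FunctionAlgebra.hDt, F.Dt_ratW_inv hij, mul_zero,
      mul_zero, add_zero]
  have h2 : κ.lax i = κ.lax j +
      (F.ratW (coord i) - F.ratW (coord j)) • cornerUnit (WKB 𝒜) q := by
    rw [← lax_sub_lax]; abel
  have h3 := F.ratW_inv_mul hij
  rw [map_app_lax hδ hij, h1, connection]
  have h4 : F.ratW (coord i - coord j)⁻¹ • (κ.lax j * κ.P j a - κ.P j a * κ.lax j) +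
      (F.ratW (coord i - coord j)⁻¹ • κ.P j a) * κ.lax i -
        κ.lax i * (F.ratW (coord i - coord j)⁻¹ • κ.P j a) =
      κ.P j a * cornerUnit (WKB 𝒜) q - cornerUnit (WKB 𝒜) q * κ.P j a := by
    rw [h2, Matrix.mul_add, Matrix.add_mul, Matrix.mul_smul, Matrix.smul_mul, Matrix.smul_mul,
      Matrix.mul_smul, Matrix.mul_smul, Matrix.smul_mul, smul_smul, smul_smul,
      mul_comm (_ - _), h3, one_smul, one_smul, smul_sub]
    abel
  rw [← h4, Matrix.add_mul, Matrix.mul_add]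
  abel

/-! ### Good functions -/

/-- By minimality of the ring of expressions: the good ring contains its generators and, by
compatibility, is stable under `∂_t`. -/
theorem Good.expressions_le (hδ : δ.Compatible) {k : ℕ} {S : Set ℕ} {j : ℕ} (hj : j ∈ S)
    (hP : ∀ b i n, δ.Good k S (κ.P j b i n)) : κ.expressions j ≤ δ.goodRing k S :=
  sInf_le ⟨fun _ h h' => good_ofSeries h h',
    fun _ hr => good_ratW (ratIn_mono (Set.singleton_subset_iff.2 hj) hr), hP, fun _ hf => hf.Dt hδ⟩

theorem Good.lax {k : ℕ} {S : Set ℕ} {j : ℕ} (hj : j ∈ S)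
    (hu : ∀ l, δ.Good k S (ofPS (κ.u l))) (i n : Fin q) : κ.lax j i n ∈ δ.goodRing k S := by
  simp only [Reduction.lax, companion, Matrix.of_apply]
  have h0 : (0 : WKB 𝒜) ∈ δ.goodRing k S := Subring.zero_mem _
  have h1 : (1 : WKB 𝒜) ∈ δ.goodRing k S := Subring.one_mem _
  have hx : F.ratW (coord j) ∈ δ.goodRing k S := good_ratW (coord_mem_ratIn hj)
  rw [ofPS_coef]
  refine ite_mem.2 ⟨fun _ => Subring.sub_mem _ (ite_mem.2 ⟨fun _ => hx, fun _ => h0⟩) (hu n),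
    fun _ => ite_mem.2 ⟨fun _ => h1, fun _ => h0⟩⟩

theorem Good.B {k : ℕ} {S : Set ℕ} {j : ℕ} {a : Fin q}
    (hP : ∀ i n, δ.Good k S (κ.P j a i n)) (i n : Fin q) : κ.B j a i n ∈ δ.goodRing k S := by
  simp only [Reduction.B, Matrix.of_apply]
  split_ifs
  · exact hP _ _
  · exact Subring.zero_mem _

/-- Inverting the commutator with `L` on matrices `X = X P + P X` preserves good functions. -/
theorem Good.of_commutator {k : ℕ} {S : Set ℕ} {j : ℕ} (hj : j ∈ S) {b : Fin q}
    (hL : ∀ i n, κ.lax j i n ∈ δ.goodRing k S) (hP : ∀ i n, κ.P j b i n ∈ δ.goodRing k S)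
    {X : Matrix (Fin q) (Fin q) (WKB 𝒜)} (hX : ∀ i n, hbar * X i n ∈ δ.goodRing k S)
    (hLX : ∀ i n, (κ.lax j * X - X * κ.lax j) i n ∈ δ.goodRing k S)
    (hPX : ∀ i n, (X * κ.P j b + κ.P j b * X - X) i n ∈ δ.goodRing k S) (i n : Fin q) :
    X i n ∈ δ.goodRing k S := by
  -- Since `ħ` is invertible in the ring of functions of the points, only the order in `ħ` is at
  -- stake.
  have hXp : ∀ (k : ℕ) (S : Set ℕ) (X : Matrix (Fin q) (Fin q) (WKB 𝒜)),
      (∀ i n, hbar * X i n ∈ δ.goodRing k S) → ∀ i n, X i n ∈ κ.pointRing S := by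
    intro k S X hX i n
    have h := Subring.mul_mem _ (κ.hpow_mem_pointRing S (-1)) (hX i n).zero_level.1
    rwa [← mul_assoc, hpow_neg_one_mul_hbar, one_mul] at h
  induction k generalizing S X i n with
  | zero =>
    refine ⟨hXp 0 S X hX i n, ?_⟩
    have hex : ∀ i n, ∃ f : PowerSeries 𝒜, hbar * X i n = ofPS f := fun i n =>
      isBigOh_zero_iff.1 (hX i n).2
    choose Y hY using hex
    have hY' : (hbar : WKB 𝒜) • X = (Matrix.of Y).map ofPS := by
      ext1 i n
      exact hY i n
    -- A power series matrix equal to `ħ` times an `O(1)` matrix vanishes at `ħ = 0`; applied to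
    -- both relations satisfied by `ħ X`.
    have hdiv : ∀ Z : Matrix (Fin q) (Fin q) (PowerSeries 𝒜), ∀ Z' : Matrix (Fin q) (Fin q) (WKB 𝒜),
        (∀ i n, Z' i n ∈ δ.goodRing 0 S) → Z.map ofPS = (hbar : WKB 𝒜) • Z' →
          Z.map PowerSeries.constantCoeff = 0 := by
      intro Z Z' hZ' h
      ext i n
      obtain ⟨g, hg⟩ := isBigOh_zero_iff.1 (hZ' i n).2
      have h1 := congrFun (congrFun h i) n
      rw [Matrix.map_apply, Matrix.smul_apply, hg, smul_eq_mul, ← ofPS_X, ← map_mul] at h1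
      rw [Matrix.map_apply, ofPS_injective h1]
      simp
    have h1 := hdiv (companion (κ.coef j) * Matrix.of Y - Matrix.of Y * companion (κ.coef j)) _ hLX
      (by
        rw [Matrix.map_sub _ (map_sub _), Matrix.map_mul, Matrix.map_mul, ← hY', ← lax_eq_map,
          Matrix.mul_smul, Matrix.smul_mul, smul_sub])
    have h2 := hdiv (Matrix.of Y * κ.projPS j b + κ.projPS j b * Matrix.of Y - Matrix.of Y) _ hPX
      (by
        rw [Matrix.map_sub _ (map_sub _), Matrix.map_add _ (map_add _), Matrix.map_mul,
          Matrix.map_mul, ← hY', ← P_eq_map, Matrix.mul_smul, Matrix.smul_mul, smul_sub, smul_add])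
    rw [Matrix.map_sub _ (map_sub _), Matrix.map_mul, Matrix.map_mul, sub_eq_zero] at h1
    rw [Matrix.map_sub _ (map_sub _), Matrix.map_add _ (map_add _), Matrix.map_mul, Matrix.map_mul,
      sub_eq_zero] at h2
    have h3 := congrFun (congrFun (κ.map_constantCoeff_eq_zero j b _ h1 h2) i) n
    obtain ⟨g, hg⟩ := PowerSeries.X_dvd_iff.2 h3
    refine isBigOh_zero_iff.2 ⟨g, ?_⟩
    have h4 := hY i n
    rw [show Y i n = PowerSeries.X * g from hg, map_mul, ofPS_X] at h4
    calc X i n = hpow (-1) * (hbar * X i n) := by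
          rw [← mul_assoc, hpow_neg_one_mul_hbar, one_mul]
      _ = _ := by rw [h4, ← mul_assoc, hpow_neg_one_mul_hbar, one_mul]
  | succ k ih =>
    have hXk : ∀ i n, X i n ∈ δ.goodRing k S :=
      ih hj (fun i n => (hL i n).1) (fun i n => (hP i n).1) (fun i n => (hX i n).1)
        (fun i n => (hLX i n).1) (fun i n => (hPX i n).1)
    refine ⟨hXk i n, fun z hz a => ?_⟩
    have hs : S ⊆ insert z S := Set.subset_insert z S
    have hd := δ.derivOn_app z a
    have hT := pointRing_le (κ := κ) hz
    have hXT : ∀ i n, X i n ∈ κ.pointRing {z}ᶜ := fun i n => hT (hXk i n).zero_level.1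
    have hLT : ∀ i n, κ.lax j i n ∈ κ.pointRing {z}ᶜ := fun i n => hT (hL i n).zero_level.1
    have hPT : ∀ i n, κ.P j b i n ∈ κ.pointRing {z}ᶜ := fun i n => hT (hP i n).zero_level.1
    have hXk' : ∀ i n, X i n ∈ δ.goodRing k (insert z S) := fun i n => (hXk i n).mono hs
    -- Applying `ħ⁻¹ δ` to the three hypotheses gives the same ones for `ħ⁻¹ δ X`, up to products of
    -- `X` with `dL` and `dP`. These are good one level lower, by the induction hypothesis for `X`
    -- itself.
    set dL := (hpow (-1) : WKB 𝒜) • (κ.lax j).map (δ.app z a) with hdL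
    set dP := (hpow (-1) : WKB 𝒜) • (κ.P j b).map (δ.app z a) with hdP
    have hdLk : ∀ i n, dL i n ∈ δ.goodRing k (insert z S) := fun i n => (hL i n).2 z hz a
    have hdPk : ∀ i n, dP i n ∈ δ.goodRing k (insert z S) := fun i n => (hP i n).2 z hz a
    refine ih (X := (hpow (-1) : WKB 𝒜) • X.map (δ.app z a)) (hs hj)
      (fun i n => (hL i n).1.mono hs) (fun i n => (hP i n).1.mono hs) (fun i n => ?_)
      (fun i n => ?_) (fun i n => ?_) i n
    · have h := (hX i n).2 z hz a
      rw [← hpow_one, δ.app_hpow_mul z a 1 (hXT i n), ← mul_assoc, ← hpow_add] at h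
      rw [Matrix.smul_apply, smul_eq_mul, ← mul_assoc, hbar_mul_hpow_neg_one]
      exact h
    · have h := (hLX i n).2 z hz a
      have e : κ.lax j * ((hpow (-1) : WKB 𝒜) • X.map (δ.app z a)) -
          ((hpow (-1) : WKB 𝒜) • X.map (δ.app z a)) * κ.lax j =
          (hpow (-1) : WKB 𝒜) • (κ.lax j * X - X * κ.lax j).map (δ.app z a) -
            (dL * X - X * dL) := by
        have e1 : (κ.lax j * X - X * κ.lax j).map (δ.app z a) =
            (κ.lax j * X).map (δ.app z a) - (X * κ.lax j).map (δ.app z a) := by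
          ext1 i n
          exact hd.sub (matrix_mul_mem hLT hXT i n) (matrix_mul_mem hXT hLT i n)
        rw [e1, hd.map_matrix_mul hLT hXT, hd.map_matrix_mul hXT hLT, hdL]
        simp only [Matrix.mul_smul, Matrix.smul_mul, smul_sub, smul_add]
        abel
      rw [e]
      exact Subring.sub_mem _ h
        (matrix_sub_mem (matrix_mul_mem hdLk hXk') (matrix_mul_mem hXk' hdLk) i n)
    · have h := (hPX i n).2 z hz a
      have e : ((hpow (-1) : WKB 𝒜) • X.map (δ.app z a)) * κ.P j b +
          κ.P j b * ((hpow (-1) : WKB 𝒜) • X.map (δ.app z a)) -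
            (hpow (-1) : WKB 𝒜) • X.map (δ.app z a) =
          (hpow (-1) : WKB 𝒜) • (X * κ.P j b + κ.P j b * X - X).map (δ.app z a) -
            (X * dP + dP * X) := by
        have e1 : (X * κ.P j b + κ.P j b * X - X).map (δ.app z a) =
            (X * κ.P j b).map (δ.app z a) + (κ.P j b * X).map (δ.app z a) -
              X.map (δ.app z a) := by
          ext1 i n
          have m1 := matrix_mul_mem hXT hPT i n
          have m2 := matrix_mul_mem hPT hXT i n
          simp only [Matrix.map_apply, Matrix.sub_apply, Matrix.add_apply]
          rw [hd.sub (Subring.add_mem _ m1 m2) (hXT i n), hd.add _ m1 _ m2]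
        rw [e1, hd.map_matrix_mul hPT hXT, hd.map_matrix_mul hXT hPT, hdP]
        simp only [Matrix.mul_smul, Matrix.smul_mul, smul_sub, smul_add]
        abel
      rw [e]
      exact Subring.sub_mem _ h (Subring.add_mem _ (matrix_mul_mem hXk' hdPk i n)
        (matrix_mul_mem hdPk hXk' i n))

end InsertionOperator

end Reduction

namespace Reduction

variable {𝒜 : Type*} [CommRing 𝒜] [Algebra ℂ 𝒜] {F : FunctionAlgebra 𝒜} {q : ℕ}
  {κ : Reduction F q}

namespace InsertionOperator

variable {δ : κ.InsertionOperator}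

/-! ### Insertions in the coefficients of `Q` and in the projectors -/

section Projectors

variable {V : ℕ → Fin q → Matrix (Fin q) (Fin q) (WKB 𝒜)}

theorem app_ofPS_u {i j : ℕ} (hij : i ≠ j) (a e n : Fin q) (he : (e : ℕ) + 1 = q) :
    δ.app j a (ofPS (κ.u n)) = -δ.app j a (κ.lax i e n) := by
  have hi : i ∈ ({j}ᶜ : Set ℕ) := hij
  have h1 : κ.lax i e n = (if (n : ℕ) = 0 then F.ratW (coord i) else 0) - ofPS (κ.u n) := by
    simp [lax, companion, he, ofPS_coef]
  have h2 : (if (n : ℕ) = 0 then F.ratW (coord i) else 0) ∈ κ.pointRing {j}ᶜ :=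
    ite_mem.2 ⟨fun _ => κ.ratW_mem_pointRing (coord_mem_ratIn hi), fun _ => Subring.zero_mem _⟩
  have h3 : δ.app j a (if (n : ℕ) = 0 then F.ratW (coord i) else 0) = 0 := by
    split_ifs
    · exact δ.der_rat j a _ (coord_mem_ratIn hi)
    · exact (δ.derivOn_app j a).zero
  rw [h1, (δ.derivOn_app j a).sub h2 (κ.ofPS_u_mem_pointRing hi n), h3, zero_sub, neg_neg]

/-- `last_row_commutator` makes the contribution of `P` and `B` an `ħ ∂_t`; the terms from `V` and
from `ħ ∂_t U` carry `ħ` explicitly. -/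
theorem app_lax_last_row (hδ : δ.Compatible) (hU : ∀ j a, δ.U j a = κ.B j a + (hbar : WKB 𝒜) • V j a)
    {i j : ℕ} (hij : i ≠ j) (a e n : Fin q) (he : (e : ℕ) + 1 = q) :
    δ.app j a (κ.lax i e n) = hbar *
      ((∑ s : Fin q, if h : (n : ℕ) + s + 1 < q then F.Dt (κ.P j a s ⟨n + s + 1, h⟩) else 0) +
        (V j a * κ.lax i - κ.lax i * V j a) e n + F.Dt (δ.U j a e n)) := by
  have h1 := congrFun (congrFun (map_app_lax_eq hδ hij a) e) n
  have h2 := last_row_commutator (fun l => ofPS (κ.coef j l)) (fun l => ofPS (κ.coef i l))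
    (κ.P j a) (κ.B j a) _ (fun l hl => by simp [ofPS_coef, hl]) (κ.map_hDt_P j a) rfl e n he
  have h3 : κ.P j a * cornerUnit (WKB 𝒜) q - cornerUnit (WKB 𝒜) q * κ.P j a +
      (δ.U j a).map F.hDt + δ.U j a * κ.lax i - κ.lax i * δ.U j a =
      (κ.P j a * cornerUnit (WKB 𝒜) q - cornerUnit (WKB 𝒜) q * κ.P j a +
        κ.B j a * κ.lax i - κ.lax i * κ.B j a) +
        (hbar : WKB 𝒜) • (V j a * κ.lax i - κ.lax i * V j a) + (δ.U j a).map F.hDt := by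
    rw [hU, Matrix.add_mul, Matrix.mul_add, Matrix.smul_mul, Matrix.mul_smul, smul_sub]
    abel
  rw [h3, Matrix.add_apply, Matrix.add_apply] at h1
  rw [Matrix.map_apply] at h1
  rw [h1, lax, h2, Matrix.smul_apply, smul_eq_mul, Matrix.map_apply, mul_add, mul_add,
    Finset.mul_sum]
  congr 2
  refine Finset.sum_congr rfl fun s _ => ?_
  split_ifs
  · rfl
  · rw [mul_zero]

/-- The induction treats all points at once, since an insertion at `y` brings in `P(y)`. In the
step, the `u_l` reach level `k + 1` first: the argument for `P` then needs `ħ⁻¹ δ L` at level `k`.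
-/
theorem good_u_and_P (hδ : δ.Compatible) (hV : ∀ j a k l, V j a k l ∈ κ.expressions j)
    (hU : ∀ j a, δ.U j a = κ.B j a + (hbar : WKB 𝒜) • V j a) (k : ℕ) :
    (∀ (S : Set ℕ) (x : ℕ), x ∈ S → ∀ l, δ.Good k S (ofPS (κ.u l))) ∧
      ∀ (S : Set ℕ) (x : ℕ), x ∈ S → ∀ b i n, δ.Good k S (κ.P x b i n) := by
  induction k with
  | zero =>
    exact ⟨fun S x hx l => ⟨κ.ofPS_u_mem_pointRing hx l, isBigOh_zero_iff.2 ⟨_, rfl⟩⟩,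
      fun S x hx b i n => ⟨κ.P_mem_pointRing hx b i n, κ.isBigOh_zero_P x b i n⟩⟩
  | succ k ih =>
    obtain ⟨hu, hP⟩ := ih
    have hVk : ∀ (S : Set ℕ) (y : ℕ), y ∈ S → ∀ a i n, V y a i n ∈ δ.goodRing k S :=
      fun S y hy a i n => Good.expressions_le hδ hy (hP S y hy) (hV y a i n)
    have hUk : ∀ (S : Set ℕ) (y : ℕ), y ∈ S → ∀ a i n, δ.U y a i n ∈ δ.goodRing k S := by
      intro S y hy a i n
      rw [hU]
      exact Subring.add_mem _ (Good.B (hP S y hy a) i n)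
        (Subring.mul_mem _ good_hbar (hVk S y hy a i n))
    have hLk : ∀ (S : Set ℕ) (x : ℕ), x ∈ S → ∀ i n, κ.lax x i n ∈ δ.goodRing k S :=
      fun S x hx => Good.lax hx (hu S x hx)
    have hu' : ∀ (S : Set ℕ) (x : ℕ), x ∈ S → ∀ l, δ.Good (k + 1) S (ofPS (κ.u l)) := by
      intro S x hx n
      refine ⟨hu S x hx n, fun y hy a => ?_⟩
      have hxy : x ≠ y := fun h => hy (h ▸ hx)
      have hx' : x ∈ insert y S := Set.mem_insert_of_mem y hx
      have hy' : y ∈ insert y S := Set.mem_insert y S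
      have hq : q - 1 + 1 = q := by have := n.2; omega
      rw [app_ofPS_u hxy a ⟨q - 1, by omega⟩ n hq,
        app_lax_last_row hδ hU hxy a ⟨q - 1, by omega⟩ n hq, hpow_neg_one_mul_neg]
      refine Subring.neg_mem (δ.goodRing k (insert y S)) (Subring.add_mem _ (Subring.add_mem _
        (Subring.sum_mem _ fun s _ => ?_)
        (matrix_sub_mem (matrix_mul_mem (hVk _ y hy' a) (hLk _ x hx'))
          (matrix_mul_mem (hLk _ x hx') (hVk _ y hy' a)) _ _)) ((hUk _ y hy' a _ _).Dt hδ))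
      split_ifs with h
      · exact (hP _ y hy' a _ _).Dt hδ
      · exact Subring.zero_mem _
    refine ⟨hu', fun S x hx b i n => ⟨hP S x hx b i n, fun y hy a => ?_⟩⟩
    have hxy : x ≠ y := fun h => hy (h ▸ hx)
    have hx' : x ∈ insert y S := Set.mem_insert_of_mem y hx
    have hy' : y ∈ insert y S := Set.mem_insert y S
    have hPk : ∀ i n, κ.P x b i n ∈ δ.goodRing k (insert y S) := hP _ x hx' b
    have hd := δ.derivOn_app y a
    have hx'' : x ∈ ({y}ᶜ : Set ℕ) := hxy
    have hPT := κ.P_mem_pointRing hx'' b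
    have hLT := κ.lax_mem_pointRing hx''
    set X := (κ.P x b).map (δ.app y a) with hX
    -- The commutator formula only shows `δ P` good, with no gain of `ħ`; this is the a priori bound
    -- on `ħ X`.
    have hXk : ∀ i n, X i n ∈ δ.goodRing k (insert y S) := by
      have hN : ∀ i n, δ.connection y a x i n ∈ δ.goodRing k (insert y S) := fun i n =>
        Subring.add_mem _ (Subring.mul_mem _ (good_ratW (inv_mem (sub_mem (coord_mem_ratIn hx')
          (coord_mem_ratIn hy')))) (hP _ y hy' a i n)) (hUk _ y hy' a i n)
      rw [hX, map_app_P hxy]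
      exact matrix_sub_mem (matrix_mul_mem hN hPk) (matrix_mul_mem hPk hN)
    set dL := (hpow (-1) : WKB 𝒜) • (κ.lax x).map (δ.app y a) with hdL
    have hdLk : ∀ i n, dL i n ∈ δ.goodRing k (insert y S) := fun i n =>
      (Good.lax hx (hu' S x hx) i n).2 y hy a
    refine Good.of_commutator (X := (hpow (-1) : WKB 𝒜) • X) hx' (hLk _ x hx') hPk (fun i n => ?_)
      (fun i n => ?_) (fun i n => ?_) i n
    · rw [Matrix.smul_apply, smul_eq_mul, ← mul_assoc, hbar_mul_hpow_neg_one, one_mul]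
      exact hXk i n
    · have h1 : ((κ.P x b).map F.hDt).map (δ.app y a) = X.map F.hDt := by
        ext1 i n
        exact app_hDt hδ y a (hPT i n)
      have h2 : ((κ.P x b).map F.hDt).map (δ.app y a) =
          (κ.lax x * κ.P x b).map (δ.app y a) - (κ.P x b * κ.lax x).map (δ.app y a) := by
        rw [map_hDt_P]
        ext1 i n
        exact hd.sub (matrix_mul_mem hLT hPT i n) (matrix_mul_mem hPT hLT i n)
      rw [h1, hd.map_matrix_mul hLT hPT, hd.map_matrix_mul hPT hLT] at h2
      have h3 : X.map F.hDt = (hbar : WKB 𝒜) • X.map F.Dt := rfl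
      have h4 : κ.lax x * ((hpow (-1) : WKB 𝒜) • X) - ((hpow (-1) : WKB 𝒜) • X) * κ.lax x =
          X.map F.Dt - (dL * κ.P x b - κ.P x b * dL) := by
        have h5 : X.map F.Dt = (hpow (-1) : WKB 𝒜) • X.map F.hDt := by
          rw [h3, smul_smul, hpow_neg_one_mul_hbar, one_smul]
        rw [h5, h2, hdL]
        simp only [Matrix.mul_smul, Matrix.smul_mul, smul_sub, smul_add]
        abel
      rw [h4]
      exact matrix_sub_mem (fun i n => (hXk i n).Dt hδ)
        (matrix_sub_mem (matrix_mul_mem hdLk hPk) (matrix_mul_mem hPk hdLk)) i n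
    -- Differentiating `P² = P`.
    · have h1 := hd.map_matrix_mul hPT hPT
      rw [P_mul_P, ← hX] at h1
      rw [Matrix.smul_mul, Matrix.mul_smul, ← smul_add, ← h1, sub_self]
      exact Subring.zero_mem _

end Projectors

/-! ### Insertions in the correlators -/

theorem K_apply (i j : ℕ) (a b : Fin q) : κ.K i j a b =
    F.ratW (coord i - coord j)⁻¹ * ((κ.Psi i)⁻¹ * κ.Psi j) a b := rfl

theorem K_mem_pointRing {S : Set ℕ} {i j : ℕ} (hi : i ∈ S) (hj : j ∈ S) (a b : Fin q) :
    κ.K i j a b ∈ κ.pointRing S :=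
  Subring.mul_mem _
    (κ.ratW_mem_pointRing (inv_mem (sub_mem (coord_mem_ratIn hi) (coord_mem_ratIn hj))))
    (matrix_mul_mem (κ.inv_Psi_mem_pointRing hi) (κ.Psi_mem_pointRing hj) a b)

/-- `P(y) = Ψ(y) E_c Ψ(y)⁻¹` has rank-one form, so it splits the kernel at `y`; partial fractions
match the rational prefactors. -/
theorem app_K {i j y : ℕ} (hij : i ≠ j) (hi : i ≠ y) (hj : j ≠ y) (a b c : Fin q) :
    δ.app y c (κ.K i j a b) = -(κ.K i y a c * κ.K y j c b) := by
  have hi' : i ∈ ({y}ᶜ : Set ℕ) := hi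
  have hj' : j ∈ ({y}ᶜ : Set ℕ) := hj
  have hr : (coord i - coord j)⁻¹ ∈ ratIn {y}ᶜ :=
    inv_mem (sub_mem (coord_mem_ratIn hi') (coord_mem_ratIn hj'))
  have hd := δ.derivOn_app y c
  have hΨi : (κ.Psi i).map (δ.app y c) = δ.connection y c i * κ.Psi i := δ.der_Psi y c i hi
  have hΨj : (κ.Psi j).map (δ.app y c) = δ.connection y c j * κ.Psi j := δ.der_Psi y c j hj
  have h1 : ((κ.Psi i)⁻¹ * κ.Psi j).map (δ.app y c) =
      (F.ratW (coord j - coord y)⁻¹ - F.ratW (coord i - coord y)⁻¹) •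
        ((κ.Psi i)⁻¹ * κ.Psi y * Matrix.single c c 1 * ((κ.Psi y)⁻¹ * κ.Psi j)) := by
    rw [hd.map_matrix_mul (κ.inv_Psi_mem_pointRing hi') (κ.Psi_mem_pointRing hj'),
      hd.map_matrix_inv (κ.isUnit_det_Psi i) (κ.Psi_mem_pointRing hi')
        (κ.inv_Psi_mem_pointRing hi'), hΨi, hΨj]
    have h2 : (κ.Psi i)⁻¹ * (δ.connection y c i * κ.Psi i) * (κ.Psi i)⁻¹ =
        (κ.Psi i)⁻¹ * δ.connection y c i := by
      rw [Matrix.mul_assoc, Matrix.mul_assoc, Matrix.mul_nonsing_inv _ (κ.isUnit_det_Psi i),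
        Matrix.mul_one]
    have h3 : (κ.Psi i)⁻¹ * κ.Psi y * Matrix.single c c 1 * ((κ.Psi y)⁻¹ * κ.Psi j) =
        (κ.Psi i)⁻¹ * κ.P y c * κ.Psi j := by
      simp only [P, Matrix.mul_assoc]
    rw [h2, h3]
    exact mul_smul_add_mul_sub _ _ _ _ _ _
  have h4 := congrFun (congrFun h1 a) b
  rw [Matrix.map_apply, Matrix.smul_apply, smul_eq_mul, mul_single_mul_apply] at h4
  have h5 : (coord i - coord j)⁻¹ * ((coord j - coord y)⁻¹ - (coord i - coord y)⁻¹) =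
      -((coord i - coord y)⁻¹ * (coord y - coord j)⁻¹) := by
    have e1 := FunctionAlgebra.coord_sub_ne_zero hij
    have e2 := FunctionAlgebra.coord_sub_ne_zero hi
    have e3 := FunctionAlgebra.coord_sub_ne_zero hj
    have e4 : coord y - coord j = -(coord j - coord y) := by ring
    rw [e4]
    field_simp
    ring
  have h6 := congrArg F.ratW h5
  rw [F.ratW_mul, F.ratW_sub, F.ratW_neg, F.ratW_mul] at h6
  rw [K_apply, hd.mul _ (κ.ratW_mem_pointRing hr) _
    (matrix_mul_mem (κ.inv_Psi_mem_pointRing hi') (κ.Psi_mem_pointRing hj') a b), h4,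
    show δ.app y c (F.ratW (coord i - coord j)⁻¹) = 0 from δ.der_rat y c _ hr, K_apply, K_apply]
  linear_combination ((κ.Psi i)⁻¹ * κ.Psi y) a c * ((κ.Psi y)⁻¹ * κ.Psi j) c b * h6

end InsertionOperator

end Reduction

/-! ### Cycles of full support -/

/-- A permutation with only one orbit. -/
def IsFullCycle {n : ℕ} (σ : Equiv.Perm (Fin n)) : Prop := ∀ x y, σ.SameCycle x y

/-- At least two points are needed: on one point the identity has a single orbit but is not a cycle
in the sense of `Equiv.Perm.IsCycle`. -/
theorem isFullCycle_iff {n : ℕ} (σ : Equiv.Perm (Fin (n + 2))) :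
    IsFullCycle σ ↔ σ.IsCycle ∧ σ.support = Finset.univ := by
  constructor
  · intro h
    have hne : ∀ x, σ x ≠ x := by
      intro x hx
      obtain ⟨y, hy⟩ := exists_ne x
      exact hy ((Equiv.Perm.SameCycle.eq_of_left (h x y) hx).symm)
    exact ⟨⟨0, hne 0, fun y _ => h 0 y⟩, Finset.eq_univ_of_forall fun x =>
      Equiv.Perm.mem_support.2 (hne x)⟩
  · rintro ⟨h, hs⟩ x y
    exact h.sameCycle (Equiv.Perm.mem_support.1 (hs ▸ Finset.mem_univ x))
      (Equiv.Perm.mem_support.1 (hs ▸ Finset.mem_univ y))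

theorem IsFullCycle.apply_ne {n : ℕ} {σ : Equiv.Perm (Fin (n + 2))} (h : IsFullCycle σ)
    (x : Fin (n + 2)) : σ x ≠ x :=
  Equiv.Perm.mem_support.1 (((isFullCycle_iff σ).1 h).2 ▸ Finset.mem_univ x)

theorem not_isFullCycle_decomposeFin_zero {n : ℕ} (e : Equiv.Perm (Fin (n + 1))) :
    ¬IsFullCycle (Equiv.Perm.decomposeFin.symm (0, e)) := fun h =>
  h.apply_ne 0 (Equiv.Perm.decomposeFin_symm_apply_zero 0 e)

/-- The permutation coded by `(i.succ, e)` is `e` with `0` inserted in the arrow ending at `i`. -/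
theorem decomposeFin_symm_succ_apply {n : ℕ} (i : Fin n) (e : Equiv.Perm (Fin n)) (x : Fin n) :
    Equiv.Perm.decomposeFin.symm (i.succ, e) x.succ = if e x = i then 0 else (e x).succ := by
  rw [Equiv.Perm.decomposeFin_symm_apply_succ]
  split_ifs with h
  · rw [h, Equiv.swap_apply_right]
  · exact Equiv.swap_apply_of_ne_of_ne (Fin.succ_ne_zero _)
      fun h' => h (Fin.succ_injective _ h')

theorem isFullCycle_decomposeFin_succ {n : ℕ} (i : Fin n) (e : Equiv.Perm (Fin n)) :
    IsFullCycle (Equiv.Perm.decomposeFin.symm (i.succ, e)) ↔ IsFullCycle e := by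
  set σ := Equiv.Perm.decomposeFin.symm (i.succ, e) with hσ
  have h0 : σ 0 = i.succ := Equiv.Perm.decomposeFin_symm_apply_zero _ _
  have hs : ∀ x : Fin n, σ x.succ = if e x = i then 0 else (e x).succ :=
    decomposeFin_symm_succ_apply i e
  constructor
  · intro h
    -- Collapsing `0` onto `i` sends each step of `σ` to at most one step of `e`; conversely, a step
    -- of `e` is one or two steps of `σ`.
    set r : Fin (n + 1) → Fin n := Fin.cases i id with hr
    have hstep : ∀ z, e.SameCycle (r z) (r (σ z)) := by
      intro z
      refine Fin.cases ?_ (fun x => ?_) z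
      · rw [h0]
        exact Equiv.Perm.SameCycle.refl e i
      · rw [hs]
        split_ifs with hx
        · exact ⟨1, hx⟩
        · exact ⟨1, rfl⟩
    have hpow : ∀ (m : ℕ) z, e.SameCycle (r z) (r ((σ ^ m) z)) := by
      intro m
      induction m with
      | zero => exact fun z => Equiv.Perm.SameCycle.refl e _
      | succ m ih =>
        intro z
        rw [pow_succ', Equiv.Perm.mul_apply]
        exact (ih z).trans (hstep _)
    intro x y
    obtain ⟨m, -, hm⟩ := (h x.succ y.succ).exists_pow_eq'
    have := hpow m x.succ
    rwa [hm] at this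
  · intro h
    have hstep : ∀ x : Fin n, σ.SameCycle x.succ (e x).succ := by
      intro x
      by_cases hx : e x = i
      · refine ⟨2, ?_⟩
        have : σ (σ x.succ) = (e x).succ := by rw [hs, if_pos hx, h0, hx]
        exact this
      · exact ⟨1, by rw [zpow_one, hs, if_neg hx]⟩
    have hpow : ∀ (m : ℕ) (x : Fin n), σ.SameCycle x.succ ((e ^ m) x).succ := by
      intro m
      induction m with
      | zero => exact fun x => Equiv.Perm.SameCycle.refl σ _
      | succ m ih =>
        intro x
        rw [pow_succ', Equiv.Perm.mul_apply]
        exact (ih x).trans (hstep _)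
    have hi : ∀ z, σ.SameCycle i.succ z := by
      intro z
      refine Fin.cases ?_ (fun x => ?_) z
      · exact Equiv.Perm.SameCycle.symm ⟨1, h0⟩
      · obtain ⟨m, -, hm⟩ := (h i x).exists_pow_eq'
        exact hm ▸ hpow m i
    exact fun x y => (hi x).symm.trans (hi y)

open Classical in
/-- The sum over the full cycles of `n + 1` points, in terms of the insertions of the first point in
the full cycles of the other points. -/
theorem sum_isFullCycle_succ {R : Type*} [AddCommMonoid R] {n : ℕ}
    (f : Equiv.Perm (Fin (n + 2)) → R) :
    ∑ σ ∈ Finset.univ.filter IsFullCycle, f σ =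
      ∑ e ∈ Finset.univ.filter (IsFullCycle (n := n + 1)), ∑ x,
        f (Equiv.Perm.decomposeFin.symm ((e x).succ, e)) := by
  rw [Finset.sum_filter, Finset.sum_filter, ← Equiv.sum_comp Equiv.Perm.decomposeFin.symm,
    Fintype.sum_prod_type_right]
  refine Finset.sum_congr rfl fun e _ => ?_
  rw [Fin.sum_univ_succ, if_neg (not_isFullCycle_decomposeFin_zero e), zero_add]
  simp only [isFullCycle_decomposeFin_succ]
  split_ifs
  -- Arrows of `e` are relabelled by their source instead of their target.
  · exact (Equiv.sum_comp e fun i => f (Equiv.Perm.decomposeFin.symm (i.succ, e))).symm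
  · exact Finset.sum_const_zero

/-! ### Recursion and orders of the correlators -/

namespace Reduction

variable {𝒜 : Type*} [CommRing 𝒜] [Algebra ℂ 𝒜] {F : FunctionAlgebra 𝒜} {q : ℕ}
  {κ : Reduction F q}

open Classical in
theorem W_add_two (n : ℕ) (j : Fin (n + 2) → ℕ) (a : Fin (n + 2) → Fin q) :
    κ.W (n + 2) j a = (-1) ^ (n + 3) * ∑ σ ∈ Finset.univ.filter IsFullCycle,
      ∏ i, κ.K (j i) (j (σ i)) (a i) (a (σ i)) := by
  have h : (Finset.univ.filter (IsFullCycle (n := n + 2))) = Finset.univ.filter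
      (fun σ : Equiv.Perm (Fin (n + 2)) => σ.IsCycle ∧ σ.support = Finset.univ) :=
    Finset.filter_congr fun σ _ => isFullCycle_iff σ
  rw [h]
  rfl

namespace InsertionOperator

variable {δ : κ.InsertionOperator}

/-- The insertion operator maps `W_n` to `W_{n + 1}`. -/
theorem app_W (n : ℕ) (j : Fin (n + 3) → ℕ) (a : Fin (n + 3) → Fin q)
    (hj : Function.Injective j) :
    δ.app (j 0) (a 0) (κ.W (n + 2) (fun i => j i.succ) fun i => a i.succ) =
      κ.W (n + 3) j a := by
  classical
  have hd := δ.derivOn_app (j 0) (a 0)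
  have hj0 : ∀ x : Fin (n + 2), j x.succ ≠ j 0 := fun x h => Fin.succ_ne_zero x (hj h)
  have hK : ∀ x y : Fin (n + 2), κ.K (j x.succ) (j y.succ) (a x.succ) (a y.succ) ∈
      κ.pointRing {j 0}ᶜ := fun x y => K_mem_pointRing (hj0 x) (hj0 y) _ _
  have hprod : ∀ e : Equiv.Perm (Fin (n + 2)),
      ∏ x, κ.K (j x.succ) (j (e x).succ) (a x.succ) (a (e x).succ) ∈ κ.pointRing {j 0}ᶜ :=
    fun e => Subring.prod_mem _ fun x _ => hK x (e x)
  have hsum : ∑ e ∈ Finset.univ.filter (IsFullCycle (n := n + 2)),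
      ∏ x, κ.K (j x.succ) (j (e x).succ) (a x.succ) (a (e x).succ) ∈ κ.pointRing {j 0}ᶜ :=
    Subring.sum_mem _ fun e _ => hprod e
  have hsign : ∀ (m : ℕ) (f : WKB 𝒜), f ∈ κ.pointRing {j 0}ᶜ →
      δ.app (j 0) (a 0) ((-1) ^ m * f) = (-1) ^ m * δ.app (j 0) (a 0) f := by
    intro m f hf
    obtain h | h := neg_one_pow_eq_or (WKB 𝒜) m
    · rw [h, one_mul, one_mul]
    · rw [h, neg_one_mul, neg_one_mul, hd.neg hf]
  rw [W_add_two, hsign _ _ hsum, hd.sum _ fun e _ => hprod e, W_add_two (n + 1),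
    sum_isFullCycle_succ (n := n + 1), Finset.mul_sum, Finset.mul_sum]
  refine Finset.sum_congr rfl fun e he => ?_
  have he' : IsFullCycle e := (Finset.mem_filter.1 he).2
  rw [hd.prod _ fun x _ => hK x (e x), Finset.mul_sum, Finset.mul_sum]
  refine Finset.sum_congr rfl fun x _ => ?_
  have hne : j x.succ ≠ j (e x).succ := fun h =>
    he'.apply_ne x (Fin.succ_injective _ (hj h)).symm
  -- Splitting the kernel of the arrow `x → e x` is inserting `0` in it; the minus sign of `app_K`
  -- accounts for the change of sign prefactor.
  rw [app_K hne (hj0 x) (hj0 (e x)), Fin.prod_univ_succ,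
    Equiv.Perm.decomposeFin_symm_apply_zero, ← Finset.mul_prod_erase _ _ (Finset.mem_univ x),
    decomposeFin_symm_succ_apply, if_pos rfl]
  have hrest : ∏ y ∈ Finset.univ.erase x, κ.K (j y.succ)
      (j (Equiv.Perm.decomposeFin.symm ((e x).succ, e) y.succ)) (a y.succ)
      (a (Equiv.Perm.decomposeFin.symm ((e x).succ, e) y.succ)) =
      ∏ y ∈ Finset.univ.erase x, κ.K (j y.succ) (j (e y).succ) (a y.succ) (a (e y).succ) := by
    refine Finset.prod_congr rfl fun y hy => ?_
    rw [decomposeFin_symm_succ_apply, if_neg fun h => Finset.ne_of_mem_erase hy (e.injective h)]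
  rw [hrest]
  ring

/-- The only full cycle is the transposition, and its two kernels close up into a trace. This
removes the exponentials and makes `W_2` good. -/
theorem W_two (j : Fin 2 → ℕ) (a : Fin 2 → Fin q) : κ.W 2 j a =
    -(F.ratW (coord (j 0) - coord (j 1))⁻¹ * F.ratW (coord (j 1) - coord (j 0))⁻¹ *
      (κ.P (j 0) (a 0) * κ.P (j 1) (a 1)).trace) := by
  classical
  have hfull : Finset.univ.filter (IsFullCycle (n := 2)) = {Equiv.swap 0 1} := by
    ext σ
    rw [Finset.mem_filter, Finset.mem_singleton]
    constructor
    · rintro ⟨-, h⟩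
      have h2 : ∀ σ : Equiv.Perm (Fin 2), σ = 1 ∨ σ = Equiv.swap 0 1 := by decide
      obtain rfl | h' := h2 σ
      · exact absurd rfl (h.apply_ne 0)
      · exact h'
    · rintro rfl
      refine ⟨Finset.mem_univ _, (isFullCycle_iff _).2
        ⟨Equiv.Perm.isCycle_swap (by decide), by decide⟩⟩
  have htr : (κ.P (j 0) (a 0) * κ.P (j 1) (a 1)).trace =
      ((κ.Psi (j 0))⁻¹ * κ.Psi (j 1)) (a 0) (a 1) *
        ((κ.Psi (j 1))⁻¹ * κ.Psi (j 0)) (a 1) (a 0) := by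
    have h1 : κ.P (j 0) (a 0) * κ.P (j 1) (a 1) = κ.Psi (j 0) * (Matrix.single (a 0) (a 0) 1 *
        (((κ.Psi (j 0))⁻¹ * κ.Psi (j 1)) * Matrix.single (a 1) (a 1) 1 * (κ.Psi (j 1))⁻¹)) := by
      simp only [P, Matrix.mul_assoc]
    have h2 : Matrix.single (a 0) (a 0) 1 *
        (((κ.Psi (j 0))⁻¹ * κ.Psi (j 1)) * Matrix.single (a 1) (a 1) 1 * (κ.Psi (j 1))⁻¹) *
          κ.Psi (j 0) = Matrix.single (a 0) (a 0) 1 *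
        (((κ.Psi (j 0))⁻¹ * κ.Psi (j 1)) * Matrix.single (a 1) (a 1) 1 *
          ((κ.Psi (j 1))⁻¹ * κ.Psi (j 0))) := by
      simp only [Matrix.mul_assoc]
    rw [h1, Matrix.trace_mul_comm, h2, Matrix.trace_single_mul, mul_single_mul_apply]
    simp
  rw [W_add_two, hfull, Finset.sum_singleton, Fin.prod_univ_two, Equiv.swap_apply_left,
    Equiv.swap_apply_right, K_apply, K_apply, htr]
  ring

variable {V : ℕ → Fin q → Matrix (Fin q) (Fin q) (WKB 𝒜)}

/-- The level `k` stays free in the induction on `n`, because every added point uses up one level.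
-/
theorem exists_good_W (hδ : δ.Compatible) (hV : ∀ j a k l, V j a k l ∈ κ.expressions j)
    (hU : ∀ j a, δ.U j a = κ.B j a + (hbar : WKB 𝒜) • V j a) (n k : ℕ) (j : Fin (n + 2) → ℕ)
    (a : Fin (n + 2) → Fin q) (hj : Function.Injective j) :
    ∃ g, δ.Good k (Set.range j) g ∧ κ.W (n + 2) j a = hpow n * g := by
  induction n generalizing k with
  | zero =>
    refine ⟨κ.W 2 j a, ?_, by rw [Nat.cast_zero, hpow_zero, one_mul]⟩
    have hP := (good_u_and_P hδ hV hU k).2 (Set.range j)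
    have hx : ∀ i, coord (j i) ∈ ratIn (Set.range j) := fun i => coord_mem_ratIn ⟨i, rfl⟩
    rw [W_two]
    refine Subring.neg_mem (δ.goodRing k _) (Subring.mul_mem _ (Subring.mul_mem _
      (good_ratW (inv_mem (sub_mem (hx 0) (hx 1)))) (good_ratW (inv_mem (sub_mem (hx 1) (hx 0)))))
      (Subring.sum_mem _ fun i _ => ?_))
    exact matrix_mul_mem (hP (j 0) ⟨0, rfl⟩ (a 0)) (hP (j 1) ⟨1, rfl⟩ (a 1)) i i
  | succ n ih =>
    obtain ⟨g, hg, hW⟩ := ih (k + 1) (fun i => j i.succ) (fun i => a i.succ)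
      (hj.comp (Fin.succ_injective _))
    have h0 : j 0 ∉ Set.range fun i : Fin (n + 2) => j i.succ := by
      rintro ⟨x, hx⟩
      exact Fin.succ_ne_zero x (hj hx)
    refine ⟨hpow (-1) * δ.app (j 0) (a 0) g, (hg.2 (j 0) h0 (a 0)).mono ?_, ?_⟩
    · rintro i (rfl | ⟨x, rfl⟩)
      · exact ⟨0, rfl⟩
      · exact ⟨x.succ, rfl⟩
    · rw [← app_W n j a hj, hW, δ.app_hpow_mul _ _ _ (pointRing_le h0 hg.zero_level.1),
        ← mul_assoc, ← hpow_add]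
      congr 2
      push_cast
      ring

end InsertionOperator

/-- The logarithmic derivative of `Ψ` has diagonal entries of order `ħ⁻¹`. -/
theorem isBigOh_W_one (j : Fin 1 → ℕ) (a : Fin 1 → Fin q) : IsBigOh (-1) (κ.W 1 j a) := by
  set x := j 0
  set c := a 0
  set T : Matrix (Fin q) (Fin q) (PowerSeries 𝒜) := Matrix.of fun i b =>
    twist (F.dx x) (κ.act x b) (κ.ampMatrix x i b) with hT
  set X := (hbar : WKB 𝒜) • ((κ.Psi x)⁻¹ * (κ.Psi x).map (F.Dx x)) with hX
  set G := (κ.ampMatrix x)⁻¹ * T with hG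
  have h1 : (hbar : WKB 𝒜) • (κ.Psi x).map (F.Dx x) = T.map ofPS * κ.expMatrix x := by
    ext1 i b
    rw [Matrix.smul_apply, Matrix.map_apply, Psi_apply, FunctionAlgebra.Dx, smul_eq_mul,
      hbar_mul_wkbDeriv_single, single_ofPowerSeries, expMatrix, Matrix.mul_diagonal]
    rfl
  -- Up to conjugation by the diagonal exponentials, `X` is a matrix of power series; on the
  -- diagonal the exponentials cancel.
  have h2 : κ.expMatrix x * X = G.map ofPS * κ.expMatrix x := by
    have h3 : κ.Psi x * X = T.map ofPS * κ.expMatrix x := by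
      rw [hX, Matrix.mul_smul, ← Matrix.mul_assoc, Matrix.mul_nonsing_inv _ (κ.isUnit_det_Psi x),
        Matrix.one_mul, h1]
    rw [hG, Matrix.map_mul, ← map_ofPS_inv, Matrix.mul_assoc, ← h3, Psi_eq, Matrix.mul_assoc,
      ← Matrix.mul_assoc _⁻¹, Matrix.nonsing_inv_mul _ (κ.isUnit_det_map_ofPS x), Matrix.one_mul]
  have h3 := congrFun (congrFun h2 c) c
  rw [expMatrix, Matrix.diagonal_mul, Matrix.mul_diagonal, mul_comm, Matrix.map_apply] at h3
  have hu : IsUnit (AddMonoidAlgebra.single (κ.act x c) 1 : WKB 𝒜) := by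
    refine IsUnit.of_mul_eq_one (AddMonoidAlgebra.single (-κ.act x c) 1) ?_
    rw [AddMonoidAlgebra.single_mul_single, add_neg_cancel, one_mul]
    rfl
  have h4 : X c c = ofPS (G c c) := hu.mul_right_cancel h3
  have h5 : κ.W 1 j a = hpow (-1) * ofPS (-G c c) := by
    have h6 : κ.W 1 j a = -((κ.Psi x)⁻¹ * (κ.Psi x).map (F.Dx x)) c c := rfl
    rw [hX, Matrix.smul_apply, smul_eq_mul] at h4
    rw [h6, map_neg, ← h4, hpow_neg_one_mul_neg]
  rw [h5]
  exact isBigOh_hpow_mul (isBigOh_zero_iff.2 ⟨_, rfl⟩) _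

end Reduction

end KP

end

theorem mainTheorem2 {𝒜 : Type*} [CommRing 𝒜] [Algebra ℂ 𝒜] (F : KP.FunctionAlgebra 𝒜)
    {q : ℕ} (κ : KP.Reduction F q) (δ : κ.InsertionOperator) (hδ : δ.Compatible)
    (V : ℕ → Fin q → Matrix (Fin q) (Fin q) (KP.WKB 𝒜))
    (hV : ∀ j a k l, V j a k l ∈ κ.expressions j)
    (hU : ∀ j a, δ.U j a = κ.B j a + (KP.hbar : KP.WKB 𝒜) • V j a) :
    (∀ (l : List (ℕ × Fin q)) (x : ℕ) (b : Fin q), (x :: l.map Prod.fst).Nodup →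
      ∀ i k, KP.IsBigOh (l.length : ℤ) (δ.iter l (κ.P x b i k))) ∧
    (∀ n : ℕ, 1 ≤ n → ∀ (j : Fin n → ℕ) (a : Fin n → Fin q), Function.Injective j →
      KP.IsBigOh ((n : ℤ) - 2) (κ.W n j a)) := by
  constructor
  · intro l x b hl i k
    rw [List.nodup_cons] at hl
    -- One level per insertion suffices; the remaining level `0` is the bound `O(1)`.
    have hP := (KP.Reduction.InsertionOperator.good_u_and_P hδ hV hU (0 + l.length)).2 {x} x rfl b i k
    obtain ⟨g, hg, h⟩ := hP.iter l hl.2 (fun j hj hjx => hl.1 (Set.mem_singleton_iff.1 hjx ▸ hj))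
    rw [h]
    exact KP.isBigOh_hpow_mul hg.2 _
  · intro n hn j a hj
    match n, hn with
    | 1, _ => exact κ.isBigOh_W_one j a
    | n + 2, _ =>
      obtain ⟨g, hg, h⟩ := KP.Reduction.InsertionOperator.exists_good_W hδ hV hU n 0 j a hj
      rw [h]
      have := KP.isBigOh_hpow_mul hg.2 n
      simpa using this
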